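/- Let $n\ge 1$. A contact manifold $(M_\#,H)$ is a smooth manifold $M_\#$ of dimension $2n+1$ with a smooth distribution $H\subset TM_\#$ of rank $2n$ whose Levi bracket $\mathcal L:H\times H\to Q:=TM_\#/H$ (the bilinear bundle map induced by the Lie bracket of vector fields, $\mathcal L(\eta(x),\zeta(x))=[\eta,\zeta](x)\bmod H_x$ for local sections $\eta,\zeta$ of $H$) is non-degenerate at each point. A contact form for $(M_\#,H)$ is a smooth one-form $\alpha$ with $\ker\alpha=H$ such that $d\alpha$ is non-degenerate on $H$ at each point (equivalently, $\alpha\wedge(d\alpha)^n$ vanishes nowhere). A transversal infinitesimal automorphism is a smooth vector field $\xi$ on $M_\#$ with $\xi(x)\notin H_x$ for all $x$ whose local flow preserves $H$. A quotient of $(M_\#,H)$ by $\xi$ is a surjective submersion $q:M_\#\to M$ with connected fibres onto a smooth manifold $M$ of dimension $2n$ such that $\ker T_xq$ is spanned by $\xi(x)$ for each $x\in M_\#$. A conformally symplectic structure on $M$ is a smooth line subbundle $\ell\subset\Lambda^2T^*M$ all of whose non-zero elements are non-degenerate as bilinear forms and which locally admits non-vanishing sections that are closed as two-forms. **Proposition.**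 Let $q:M_\#\to M$ be a quotient of a contact manifold $(M_\#,H)$ of dimension $2n+1\ge 3$ by a transversal infinitesimal automorphism $\xi$. Then: (1) For each $x\in M_\#$, the tangent map $T_xq$ restricts to a linear isomorphism $H_x\to T_{q(x)}M$. Via this isomorphism, $\mathcal L$ determines a smooth line subbundle $\ell\subset\Lambda^2T^*M$: for every $x\in M_\#$, the fibre $\ell_{q(x)}$ is the set of all $\varphi\in\Lambda^2T^*_{q(x)}M$ for which there is a linear functional $\kappa:Q_x\to\mathbb R$ with $\varphi(T_xq\,v,T_xq\,w)=\kappa(\mathcal L_x(v,w))$ for all $v,w\in H_x$. Each non-zero element of $\ell$ is non-degenerate as a bilinear form on the corresponding tangent space. (2) There is a unique contact form $\alpha$ for $(M_\#,H)$ such that $\alpha(\xi)=1$, and a unique symplectic form $\omega$ on $M$ such that $q^*\omega=d\alpha$. This form $\omega$ is a section of $\ell$, so $\ell$ is a conformally symplectic structure on $M$. -/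

import Mathlib

open Set Filter Topology Manifold VectorField
open scoped ContDiff

noncomputable section

section Differential_Forms

variable {E : Type*} [NormedAddCommGroup E] [NormedSpace ℝ E]
  {M : Type*} [TopologicalSpace M] [ChartedSpace E M]
  {F : Type*} [NormedAddCommGroup F] [NormedSpace ℝ F]
  {N : Type*} [TopologicalSpace N] [ChartedSpace F N]
  {k : ℕ}

/-- A (not necessarily smooth) differential `k`-form on the manifold `M` modelled on `E`:
an alternating `k`-linear form on every tangent space. -/
abbrev FormField (E : Type*) [NormedAddCommGroup E] [NormedSpace ℝ E]
    (M : Type*) [TopologicalSpace M] [ChartedSpace E M] (k : ℕ) : Type _ :=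
  (x : M) → TangentSpace 𝓘(ℝ, E) x [⋀^Fin k]→L[ℝ] ℝ

/-- The coordinate expression of a form in the preferred chart at `x`: its pullback under the
inverse of that chart (meaningful on the target of the chart). -/
def FormField.inChart (τ : FormField E M k) (x : M) : E → E [⋀^Fin k]→L[ℝ] ℝ := fun y =>
  (τ ((extChartAt 𝓘(ℝ, E) x).symm y)).compContinuousLinearMap
    (mfderiv 𝓘(ℝ, E) 𝓘(ℝ, E) (extChartAt 𝓘(ℝ, E) x).symm y)

/-- Smoothness of a form on an open set: at every point of the set the coordinate expression in
the chart at that point is smooth. -/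
def FormField.IsSmoothOn (τ : FormField E M k) (U : Set M) : Prop :=
  ∀ x ∈ U, ContDiffAt ℝ ∞ (τ.inChart x) (extChartAt 𝓘(ℝ, E) x x)

/-- The exterior derivative, computed at `x` in the chart at `x`. -/
def FormField.d (τ : FormField E M k) : FormField E M (k + 1) := fun x =>
  (extDeriv (τ.inChart x) (extChartAt 𝓘(ℝ, E) x x)).compContinuousLinearMap
    (mfderiv 𝓘(ℝ, E) 𝓘(ℝ, E) (extChartAt 𝓘(ℝ, E) x) x)

/-- The pullback `q^* τ` of a form on `N` along `q : M → N`. -/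
def FormField.pullback (q : M → N) (τ : FormField F N k) : FormField E M k := fun x =>
  (τ (q x)).compContinuousLinearMap (mfderiv 𝓘(ℝ, E) 𝓘(ℝ, F) q x)

/-- Non-degeneracy of an alternating two-form on a tangent space. -/
def IsNondegenerateTwoForm {x : M} (φ : TangentSpace 𝓘(ℝ, E) x [⋀^Fin 2]→L[ℝ] ℝ) : Prop :=
  ∀ v : TangentSpace 𝓘(ℝ, E) x, (∀ w : TangentSpace 𝓘(ℝ, E) x, φ ![v, w] = 0) → v = 0

/-- A symplectic form: a smooth, closed, pointwise non-degenerate two-form. -/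
structure IsSymplecticForm (τ : FormField E M 2) : Prop where
  smooth : τ.IsSmoothOn univ
  closed : τ.d = 0
  nondegenerate : ∀ x, IsNondegenerateTwoForm (τ x)

/-- A family `ℓ` of subspaces of the fibres of `Λ²T^*M` is a smooth line subbundle: locally it is
spanned by one nowhere vanishing smooth two-form. -/
def IsLineSubbundle
    (ℓ : (x : M) → Submodule ℝ (TangentSpace 𝓘(ℝ, E) x [⋀^Fin 2]→L[ℝ] ℝ)) : Prop :=
  ∀ x : M, ∃ U : Set M, IsOpen U ∧ x ∈ U ∧ ∃ τ : FormField E M 2, τ.IsSmoothOn U ∧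
    ∀ y ∈ U, τ y ≠ 0 ∧ ℓ y = Submodule.span ℝ {τ y}

/-- A conformally symplectic structure: a line subbundle `ℓ` of the bundle of two-forms all of
whose non-zero elements are non-degenerate and which locally admits non-vanishing sections that
are closed as two-forms. -/
structure IsConformallySymplectic
    (ℓ : (x : M) → Submodule ℝ (TangentSpace 𝓘(ℝ, E) x [⋀^Fin 2]→L[ℝ] ℝ)) : Prop where
  line_subbundle : IsLineSubbundle ℓ
  nondegenerate : ∀ x, ∀ φ ∈ ℓ x, φ ≠ 0 → IsNondegenerateTwoForm φ
  closed_sections : ∀ x : M, ∃ U : Set M, IsOpen U ∧ x ∈ U ∧ ∃ τ : FormField E M 2,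
    τ.IsSmoothOn U ∧ ∀ y ∈ U, τ y ∈ ℓ y ∧ τ y ≠ 0 ∧ τ.d y = 0

end Differential_Forms

section Contact

variable {E : Type*} [NormedAddCommGroup E] [NormedSpace ℝ E]
  {M : Type*} [TopologicalSpace M] [ChartedSpace E M] [IsManifold 𝓘(ℝ, E) ∞ M]

/-- Smoothness of a vector field on a set. -/
def IsSmoothFieldOn (η : (x : M) → TangentSpace 𝓘(ℝ, E) x) (U : Set M) : Prop :=
  ContMDiffOn 𝓘(ℝ, E) (𝓘(ℝ, E).prod 𝓘(ℝ, E)) ∞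
    (fun y => (⟨y, η y⟩ : TangentBundle 𝓘(ℝ, E) M)) U

/-- A smooth distribution of rank `k`, that is, a smooth rank `k` subbundle of the tangent bundle:
locally it has a smooth frame consisting of `k` vector fields. -/
def IsSmoothDistribution (H : (x : M) → Submodule ℝ (TangentSpace 𝓘(ℝ, E) x)) (k : ℕ) : Prop :=
  ∀ x : M, ∃ U : Set M, IsOpen U ∧ x ∈ U ∧ ∃ s : Fin k → (y : M) → TangentSpace 𝓘(ℝ, E) y,
    (∀ i, IsSmoothFieldOn (s i) U) ∧
      ∀ y ∈ U, LinearIndependent ℝ (fun i => s i y) ∧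
        H y = Submodule.span ℝ (Set.range fun i => s i y)

/-- `η` is, near `x`, a smooth section of `H`. -/
def IsLocalSectionAt (H : (x : M) → Submodule ℝ (TangentSpace 𝓘(ℝ, E) x)) (x : M)
    (η : (y : M) → TangentSpace 𝓘(ℝ, E) y) : Prop :=
  ∃ U : Set M, IsOpen U ∧ x ∈ U ∧ IsSmoothFieldOn η U ∧ ∀ y ∈ U, η y ∈ H y

/-- The bilinear map `L : H_x × H_x → Q_x = T_xM / H_x` is induced by the Lie bracket of
vector fields: `L (η(x), ζ(x)) = [η, ζ](x) mod H_x` for all local sections `η, ζ` of `H`. -/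
def IsInducedByLieBracket (H : (x : M) → Submodule ℝ (TangentSpace 𝓘(ℝ, E) x)) (x : M)
    (L : H x →ₗ[ℝ] H x →ₗ[ℝ] (TangentSpace 𝓘(ℝ, E) x ⧸ H x)) : Prop :=
  ∀ (η ζ : (y : M) → TangentSpace 𝓘(ℝ, E) y), IsLocalSectionAt H x η → IsLocalSectionAt H x ζ →
    ∀ v w : H x, η x = v → ζ x = w →
      L v w = Submodule.Quotient.mk (mlieBracket 𝓘(ℝ, E) η ζ x)

open Classical in
/-- The Levi bracket of a distribution at `x`: the bilinear map `H_x × H_x → T_xM / H_x` induced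
by the Lie bracket of vector fields. For a smooth distribution it exists and is unique, see
`leviBracket_isInducedByLieBracket` and `IsInducedByLieBracket.eq` below. -/
def leviBracket (H : (x : M) → Submodule ℝ (TangentSpace 𝓘(ℝ, E) x)) (x : M) :
    H x →ₗ[ℝ] H x →ₗ[ℝ] (TangentSpace 𝓘(ℝ, E) x ⧸ H x) :=
  if h : ∃ L, IsInducedByLieBracket H x L then h.choose else 0

end Contact

section Levi_Bracket_Well_Defined

variable {E : Type*} [NormedAddCommGroup E] [NormedSpace ℝ E]

/-- Differentiating, at a zero, a section of the span of a frame yields a vector in the span. -/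
theorem fderiv_mem_span_of_zero [FiniteDimensional ℝ E] {k : ℕ} {s : Fin k → E → E} {W : E → E} {a : E}
    (hs : ∀ i, DifferentiableAt ℝ (s i) a) (hW : DifferentiableAt ℝ W a)
    (hli : LinearIndependent ℝ fun i => s i a) (h0 : W a = 0)
    (hspan : ∀ᶠ y in 𝓝 a, W y ∈ Submodule.span ℝ (Set.range fun i => s i y)) (v : E) :
    fderiv ℝ W a v ∈ Submodule.span ℝ (Set.range fun i => s i a) := by
  let T : E → (Fin k → ℝ) →L[ℝ] E := fun y =>
    ∑ i, (ContinuousLinearMap.proj (R := ℝ) (φ := fun _ : Fin k => ℝ) i).smulRight (s i y)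
  have hTapp : ∀ y c, T y c = ∑ i, c i • s i y := fun y c => by simp [T]
  have hT : DifferentiableAt ℝ T a := by
    simp only [T]
    refine DifferentiableAt.fun_sum fun i _ => ?_
    exact ((ContinuousLinearMap.smulRightL ℝ (Fin k → ℝ) E
      (ContinuousLinearMap.proj (R := ℝ) (φ := fun _ : Fin k => ℝ) i)).differentiableAt.comp a (hs i))
  have hinj : Function.Injective (T a) := by
    rw [injective_iff_map_eq_zero]
    intro c hc
    rw [hTapp] at hc
    funext i
    exact Fintype.linearIndependent_iff.1 hli c hc i
  -- a continuous left inverse of `T a`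
  obtain ⟨P, hP⟩ : ∃ P : E →L[ℝ] (Fin k → ℝ), P.comp (T a) = ContinuousLinearMap.id ℝ _ := by
    obtain ⟨P, hP⟩ := (T a : (Fin k → ℝ) →ₗ[ℝ] E).exists_leftInverse_of_injective
      (LinearMap.ker_eq_bot.2 hinj)
    exact ⟨LinearMap.toContinuousLinearMap P, ContinuousLinearMap.ext fun c => LinearMap.congr_fun hP c⟩
  let B : E → (Fin k → ℝ) →L[ℝ] (Fin k → ℝ) := fun y => P.comp (T y)
  have hB : DifferentiableAt ℝ B a := (differentiableAt_const P).clm_comp hT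
  have hBa : B a = 1 := hP
  have hunit : ∀ᶠ y in 𝓝 a, IsUnit (B y) := by
    have : {u : (Fin k → ℝ) →L[ℝ] (Fin k → ℝ) | IsUnit u} ∈ 𝓝 (B a) :=
      Units.isOpen.mem_nhds (by simp [hBa])
    exact hB.continuousAt this
  let f : E → (Fin k → ℝ) := fun y => Ring.inverse (B y) (P (W y))
  have hinv : DifferentiableAt ℝ (fun y => Ring.inverse (B y)) a := by
    have h1 : DifferentiableAt ℝ (Ring.inverse : ((Fin k → ℝ) →L[ℝ] (Fin k → ℝ)) → _) (B a) := by
      rw [hBa]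
      exact differentiableAt_inverse (𝕜 := ℝ) isUnit_one
    exact h1.comp a hB
  have hf : DifferentiableAt ℝ f a := hinv.clm_apply (P.differentiableAt.comp a hW)
  have hfa : f a = 0 := by simp [f, h0]
  have hWf : W =ᶠ[𝓝 a] fun y => T y (f y) := by
    filter_upwards [hspan, hunit] with y hy hu
    obtain ⟨c, hc⟩ := (Submodule.mem_span_range_iff_exists_fun ℝ).1 hy
    rw [← hTapp] at hc
    have : f y = c := by
      simp only [f, ← hc]
      change (Ring.inverse (B y) * B y) c = c
      rw [Ring.inverse_mul_cancel _ hu]; rfl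
    rw [this, hc]
  rw [hWf.fderiv_eq, fderiv_clm_apply hT hf]
  simp only [ContinuousLinearMap.comp_apply, hfa,
    map_zero, add_zero, hTapp]
  exact (Submodule.mem_span_range_iff_exists_fun ℝ).2 ⟨_, rfl⟩


variable {M : Type*} [TopologicalSpace M] [ChartedSpace E M] [IsManifold 𝓘(ℝ, E) ∞ M]

/-- The bracket with a section of `H` vanishing at `x` lies in `H_x`, for smooth `H`. -/
theorem mlieBracket_mem_of_zero [FiniteDimensional ℝ E]
    {H : (x : M) → Submodule ℝ (TangentSpace 𝓘(ℝ, E) x)} {k : ℕ}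
    (hH : IsSmoothDistribution H k) {x : M} {η ζ : (y : M) → TangentSpace 𝓘(ℝ, E) y}
    (hζ : IsLocalSectionAt H x ζ) (h0 : ζ x = 0) : mlieBracket 𝓘(ℝ, E) η ζ x ∈ H x := by
  have : IsManifold 𝓘(ℝ, E) 2 M := IsManifold.of_le (n := ∞) (WithTop.coe_le_coe.2 le_top)
  obtain ⟨U, hU, hxU, hζs, hζH⟩ := hζ
  obtain ⟨V, hV, hxV, s, hs, hsV⟩ := hH x
  let b : ((y : M) → TangentSpace 𝓘(ℝ, E) y) → E → E := fun X =>
    mpullbackWithin 𝓘(ℝ, E) 𝓘(ℝ, E) (extChartAt 𝓘(ℝ, E) x).symm X (range 𝓘(ℝ, E))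
  let a : E := extChartAt 𝓘(ℝ, E) x x
  have hd : ∀ X : (y : M) → TangentSpace 𝓘(ℝ, E) y, ∀ W : Set M, IsOpen W → x ∈ W →
      IsSmoothFieldOn X W → DifferentiableAt ℝ (b X) a := by
    intro X W hW hxW hX
    have h1 := (hX.contMDiffAt (hW.mem_nhds hxW)).mdifferentiableAt (by simp)
    have h2 := (h1.mdifferentiableWithinAt
      (s := univ)).differentiableWithinAt_mpullbackWithin_vectorField
    have h3 : (extChartAt 𝓘(ℝ, E) x).symm ⁻¹' univ ∩ range 𝓘(ℝ, E) = univ := by simp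
    rw [h3] at h2
    exact differentiableWithinAt_univ.1 h2
  let A : E →L[ℝ] TangentSpace 𝓘(ℝ, E) x :=
    (mfderiv 𝓘(ℝ, E) 𝓘(ℝ, E) (extChartAt 𝓘(ℝ, E) x) x).inverse
  have hA : ∀ X : (y : M) → TangentSpace 𝓘(ℝ, E) y, A (b X a) = X x := fun X => by
    have h1 := mfderiv_extChartAt_inverse_comp_mfderivWithin_extChartAT_symm (I := 𝓘(ℝ, E)) (x := x)
      (X ((extChartAt 𝓘(ℝ, E) x).symm a) : E)
    have h2 : ∀ z, z = x → (X z : E) = X x := by rintro _ rfl; rfl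
    exact h1.trans (h2 _ (extChartAt_to_inv x))
  have hinj : Function.Injective A := by
    obtain ⟨e, he⟩ := isInvertible_mfderiv_extChartAt (I := 𝓘(ℝ, E)) (mem_extChartAt_source x)
    simp only [A, ← he, ContinuousLinearMap.inverse_equiv]
    exact e.symm.injective
  have hbζ : b ζ a = 0 := hinj (by rw [hA, h0, map_zero])
  have hspan : ∀ᶠ y in 𝓝 a, b ζ y ∈ Submodule.span ℝ (Set.range fun i => b (s i) y) := by
    have hc : ContinuousAt (extChartAt 𝓘(ℝ, E) x).symm a := continuousAt_extChartAt_symm x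
    have hx' : (extChartAt 𝓘(ℝ, E) x).symm a = x := extChartAt_to_inv x
    have : ∀ᶠ z in 𝓝 x, z ∈ U ∩ V := (hU.inter hV).mem_nhds ⟨hxU, hxV⟩
    rw [← hx'] at this
    filter_upwards [hc.eventually this] with y hy
    have h1 := hζH _ hy.1
    rw [(hsV _ hy.2).2] at h1
    obtain ⟨c, hc⟩ := (Submodule.mem_span_range_iff_exists_fun ℝ).1 h1
    refine (Submodule.mem_span_range_iff_exists_fun ℝ).2 ⟨c, ?_⟩
    simp only [b, mpullbackWithin_apply]
    rw [← hc, map_sum]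
    exact (Finset.sum_congr rfl fun i _ => (map_smul _ _ _).symm)
  have key : ∀ v, fderiv ℝ (b ζ) a v ∈ Submodule.span ℝ (Set.range fun i => b (s i) a) := by
    refine fderiv_mem_span_of_zero (s := fun i => b (s i)) (fun i => hd _ V hV hxV (hs i))
      (hd _ U hU hxU hζs) ?_ hbζ hspan
    refine LinearIndependent.of_comp (A : E →ₗ[ℝ] TangentSpace 𝓘(ℝ, E) x) ?_
    convert (hsV x hxV).1 using 2 with i
    exact hA (s i)
  have hbr : mlieBracket 𝓘(ℝ, E) η ζ x = A (lieBracket ℝ (b η) (b ζ) a) := by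
    rw [← mlieBracketWithin_univ, mlieBracketWithin_apply]
    have h3 : (extChartAt 𝓘(ℝ, E) x).symm ⁻¹' univ ∩ range 𝓘(ℝ, E) = univ := by simp
    rw [h3]
    exact congrArg A (congrFun (lieBracketWithin_univ (V := b η) (W := b ζ)) a)
  rw [hbr, lieBracket, hbζ, map_zero, sub_zero, (hsV x hxV).2]
  obtain ⟨c, hc⟩ := (Submodule.mem_span_range_iff_exists_fun ℝ).1 (key (b η a))
  refine (Submodule.mem_span_range_iff_exists_fun ℝ).2 ⟨c, ?_⟩
  rw [← hc, map_sum]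
  simp only [map_smul, hA]


theorem IsLocalSectionAt.mdifferentiableAt {H : (x : M) → Submodule ℝ (TangentSpace 𝓘(ℝ, E) x)}
    {x : M} {η : (y : M) → TangentSpace 𝓘(ℝ, E) y} (h : IsLocalSectionAt H x η) :
    MDifferentiableAt 𝓘(ℝ, E) (𝓘(ℝ, E).prod 𝓘(ℝ, E))
      (fun y => (⟨y, η y⟩ : TangentBundle 𝓘(ℝ, E) M)) x := by
  obtain ⟨U, hU, hxU, hs, -⟩ := h
  exact (hs.contMDiffAt (hU.mem_nhds hxU)).mdifferentiableAt (by simp)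

theorem IsLocalSectionAt.add {H : (x : M) → Submodule ℝ (TangentSpace 𝓘(ℝ, E) x)} {x : M}
    {η ζ : (y : M) → TangentSpace 𝓘(ℝ, E) y} (h : IsLocalSectionAt H x η)
    (h' : IsLocalSectionAt H x ζ) : IsLocalSectionAt H x (η + ζ) := by
  obtain ⟨U, hU, hxU, hs, hm⟩ := h
  obtain ⟨V, hV, hxV, hs', hm'⟩ := h'
  refine ⟨U ∩ V, hU.inter hV, ⟨hxU, hxV⟩, ?_, fun y hy => (H y).add_mem (hm y hy.1) (hm' y hy.2)⟩
  exact (ContMDiffOn.mono hs inter_subset_left).add_section (ContMDiffOn.mono hs' inter_subset_right)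

theorem IsLocalSectionAt.const_smul {H : (x : M) → Submodule ℝ (TangentSpace 𝓘(ℝ, E) x)} {x : M}
    {η : (y : M) → TangentSpace 𝓘(ℝ, E) y} (h : IsLocalSectionAt H x η) (c : ℝ) :
    IsLocalSectionAt H x (c • η) := by
  obtain ⟨U, hU, hxU, hs, hm⟩ := h
  exact ⟨U, hU, hxU, ContMDiffOn.const_smul_section hs, fun y hy => (H y).smul_mem c (hm y hy)⟩

/-- The class modulo `H_x` of the bracket of two local sections of `H` depends only on their
values at `x`. -/
theorem mlieBracket_sub_mem [FiniteDimensional ℝ E]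
    {H : (x : M) → Submodule ℝ (TangentSpace 𝓘(ℝ, E) x)} {k : ℕ}
    (hH : IsSmoothDistribution H k) {x : M} {η ζ η' ζ' : (y : M) → TangentSpace 𝓘(ℝ, E) y}
    (hη : IsLocalSectionAt H x η) (hζ : IsLocalSectionAt H x ζ)
    (hη' : IsLocalSectionAt H x η') (hζ' : IsLocalSectionAt H x ζ')
    (h1 : η x = η' x) (h2 : ζ x = ζ' x) :
    mlieBracket 𝓘(ℝ, E) η ζ x - mlieBracket 𝓘(ℝ, E) η' ζ' x ∈ H x := by
  have : IsManifold 𝓘(ℝ, E) 2 M := IsManifold.of_le (n := ∞) (WithTop.coe_le_coe.2 le_top)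
  have hdη := hη.add (hη'.const_smul (-1))
  have hdζ := hζ.add (hζ'.const_smul (-1))
  have e1 := mlieBracket_mem_of_zero hH (η := η) hdζ (by simp [h2])
  have e2 := mlieBracket_mem_of_zero hH (η := ζ') hdη (by simp [h1])
  rw [mlieBracket_add_right hζ.mdifferentiableAt (hζ'.const_smul (-1)).mdifferentiableAt,
    mlieBracket_const_smul_right hζ'.mdifferentiableAt] at e1
  rw [mlieBracket_swap_apply, mlieBracket_add_left hη.mdifferentiableAt
    (hη'.const_smul (-1)).mdifferentiableAt,
    mlieBracket_const_smul_left hη'.mdifferentiableAt, Submodule.neg_mem_iff] at e2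
  have e3 := (H x).add_mem e1 e2
  convert e3 using 1
  module

/-- A smooth distribution has a linear choice of local sections through the vectors of `H_x`. -/
theorem exists_linear_extension {H : (x : M) → Submodule ℝ (TangentSpace 𝓘(ℝ, E) x)} {k : ℕ}
    (hH : IsSmoothDistribution H k) (x : M) :
    ∃ e : H x →ₗ[ℝ] ((y : M) → TangentSpace 𝓘(ℝ, E) y),
      ∀ v, IsLocalSectionAt H x (e v) ∧ e v x = v := by
  obtain ⟨U, hU, hxU, s, hs, hsU⟩ := hH x
  have hloc : ∀ i, IsLocalSectionAt H x (s i) := fun i =>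
    ⟨U, hU, hxU, hs i, fun y hy => by
      rw [(hsU y hy).2]; exact Submodule.subset_span ⟨i, rfl⟩⟩
  let b : Module.Basis (Fin k) ℝ (H x) := (Module.Basis.span (hsU x hxU).1).map
    (LinearEquiv.ofEq _ _ (hsU x hxU).2.symm)
  have hb : ∀ i, (b i : TangentSpace 𝓘(ℝ, E) x) = s i x := fun i => by
    simp [b, Module.Basis.span_apply]
  refine ⟨b.constr ℝ s, fun v => ?_⟩
  rw [Module.Basis.constr_apply_fintype]
  constructor
  · refine Finset.sum_induction _ (IsLocalSectionAt H x) (fun _ _ h h' => h.add h') ?_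
      (fun i _ => (hloc i).const_smul _)
    refine ⟨U, hU, hxU, ?_, fun y _ => (H y).zero_mem⟩
    exact (Bundle.contMDiff_zeroSection ℝ (TangentSpace 𝓘(ℝ, E) (M := M))).contMDiffOn
  · have h1 := congrArg (Subtype.val) (b.sum_equivFun v)
    rw [Finset.sum_apply, ← h1, Submodule.coe_sum]
    refine Finset.sum_congr rfl fun i _ => ?_
    rw [Submodule.coe_smul, hb, Module.Basis.equivFun_apply]
    rfl

/-- For a smooth distribution the Levi bracket is indeed induced by the Lie bracket. -/
theorem leviBracket_isInducedByLieBracket [FiniteDimensional ℝ E]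
    {H : (x : M) → Submodule ℝ (TangentSpace 𝓘(ℝ, E) x)} {k : ℕ}
    (hH : IsSmoothDistribution H k) (x : M) : IsInducedByLieBracket H x (leviBracket H x) := by
  have : IsManifold 𝓘(ℝ, E) 2 M := IsManifold.of_le (n := ∞) (WithTop.coe_le_coe.2 le_top)
  suffices h : ∃ L, IsInducedByLieBracket H x L by
    rw [leviBracket, dif_pos h]
    exact h.choose_spec
  obtain ⟨e, he⟩ := exists_linear_extension hH x
  have hd := fun v => (he v).1.mdifferentiableAt
  refine ⟨LinearMap.mk₂ ℝ (fun v w => Submodule.Quotient.mk (mlieBracket 𝓘(ℝ, E) (e v) (e w) x))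
    ?_ ?_ ?_ ?_, ?_⟩
  · intro v v' w
    rw [map_add, mlieBracket_add_left (hd v) (hd v'), Submodule.Quotient.mk_add]
  · intro c v w
    rw [map_smul, mlieBracket_const_smul_left (hd v), Submodule.Quotient.mk_smul]
  · intro v w w'
    rw [map_add, mlieBracket_add_right (hd w) (hd w'), Submodule.Quotient.mk_add]
  · intro c v w
    rw [map_smul, mlieBracket_const_smul_right (hd w), Submodule.Quotient.mk_smul]
  · intro η ζ hη hζ v w hv hw
    rw [LinearMap.mk₂_apply, Submodule.Quotient.eq]
    exact mlieBracket_sub_mem hH (he v).1 (he w).1 hη hζ ((he v).2.trans hv.symm)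
      ((he w).2.trans hw.symm)

/-- For a smooth distribution there is only one bilinear map induced by the Lie bracket. -/
theorem IsInducedByLieBracket.eq {H : (x : M) → Submodule ℝ (TangentSpace 𝓘(ℝ, E) x)} {k : ℕ}
    (hH : IsSmoothDistribution H k) {x : M}
    {L L' : H x →ₗ[ℝ] H x →ₗ[ℝ] (TangentSpace 𝓘(ℝ, E) x ⧸ H x)}
    (h : IsInducedByLieBracket H x L) (h' : IsInducedByLieBracket H x L') : L = L' := by
  obtain ⟨e, he⟩ := exists_linear_extension hH x
  refine LinearMap.ext₂ fun v w => ?_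
  rw [h _ _ (he v).1 (he w).1 v w (he v).2 (he w).2, h' _ _ (he v).1 (he w).1 v w (he v).2 (he w).2]

end Levi_Bracket_Well_Defined

section Contact_Quotients

variable {E : Type*} [NormedAddCommGroup E] [NormedSpace ℝ E]
  {P : Type*} [TopologicalSpace P] [ChartedSpace E P] [IsManifold 𝓘(ℝ, E) ∞ P]
  {F : Type*} [NormedAddCommGroup F] [NormedSpace ℝ F]
  {M : Type*} [TopologicalSpace M] [ChartedSpace F M]

/-- `H` is a contact structure on the manifold `P` of dimension `2n+1`: a smooth distribution of
rank `2n` whose Levi bracket is non-degenerate at each point. -/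
structure IsContactStructure (n : ℕ) (H : (x : P) → Submodule ℝ (TangentSpace 𝓘(ℝ, E) x)) :
    Prop where
  dim : Module.finrank ℝ E = 2 * n + 1
  distribution : IsSmoothDistribution H (2 * n)
  nondegenerate : ∀ x, (leviBracket H x).Nondegenerate

/-- A contact form for `(P, H)`: a smooth one-form `α` with kernel `H` such that `dα` is
non-degenerate on `H = ker α` at each point. (In dimension `2n+1` the latter says that
`α ∧ (dα)^n` vanishes nowhere.) -/
structure IsContactForm (H : (x : P) → Submodule ℝ (TangentSpace 𝓘(ℝ, E) x))
    (α : FormField E P 1) : Prop where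
  smooth : α.IsSmoothOn univ
  ker : ∀ (x : P) (v : TangentSpace 𝓘(ℝ, E) x), α x ![v] = 0 ↔ v ∈ H x
  nondegenerate : ∀ x : P, ∀ v ∈ H x, (∀ w ∈ H x, α.d x ![v, w] = 0) → v = 0

/-- `φ` is the (smooth) local flow of `ξ`, for times `|t| < ε`, on the open set `U`. -/
structure IsLocalFlow (ξ : (x : P) → TangentSpace 𝓘(ℝ, E) x) (ε : ℝ) (U : Set P)
    (φ : ℝ → P → P) : Prop where
  pos : 0 < ε
  isOpen : IsOpen U
  smooth : ContMDiffOn (𝓘(ℝ, ℝ).prod 𝓘(ℝ, E)) 𝓘(ℝ, E) ∞ (fun p : ℝ × P => φ p.1 p.2)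
    (Ioo (-ε) ε ×ˢ U)
  initial : ∀ x ∈ U, φ 0 x = x
  integral : ∀ x ∈ U, IsMIntegralCurveOn (fun t => φ t x) ξ (Ioo (-ε) ε)

/-- A transversal infinitesimal automorphism of `(P, H)`: a smooth vector field `ξ` which is
nowhere in `H` and whose local flow preserves `H`. (Every smooth vector field has a local flow
around each point, and two local flows agree near the point for small times.) -/
structure IsTransversalInfinitesimalAutomorphism
    (H : (x : P) → Submodule ℝ (TangentSpace 𝓘(ℝ, E) x))
    (ξ : (x : P) → TangentSpace 𝓘(ℝ, E) x) : Prop where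
  smooth : IsSmoothFieldOn ξ univ
  transversal : ∀ x, ξ x ∉ H x
  flow_preserves : ∀ x₀ : P, ∃ (ε : ℝ) (U : Set P) (φ : ℝ → P → P), x₀ ∈ U ∧
    IsLocalFlow ξ ε U φ ∧ ∀ t ∈ Ioo (-ε) ε, ∀ x ∈ U,
      (H x).map (mfderiv 𝓘(ℝ, E) 𝓘(ℝ, E) (φ t) x).toLinearMap = H (φ t x)

/-- `q : P → M` is a quotient of the `2n+1`-dimensional manifold `P` by the vector field `ξ`:
a surjective submersion onto a `2n`-dimensional manifold with connected fibres such that the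
kernel of each tangent map of `q` is spanned by `ξ`. -/
structure IsQuotientByField (n : ℕ) (ξ : (x : P) → TangentSpace 𝓘(ℝ, E) x) (q : P → M) :
    Prop where
  dim : Module.finrank ℝ F = 2 * n
  surjective : Function.Surjective q
  submersion : Manifold.IsSubmersion 𝓘(ℝ, E) 𝓘(ℝ, F) ∞ q
  ker : ∀ x, (mfderiv 𝓘(ℝ, E) 𝓘(ℝ, F) q x).toLinearMap.ker = Submodule.span ℝ {ξ x}
  connected : ∀ y : M, IsConnected (q ⁻¹' {y})

/-- The restriction `H_x → T_{q(x)}M` of the tangent map `T_x q`. -/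
def tangentRestrict (H : (x : P) → Submodule ℝ (TangentSpace 𝓘(ℝ, E) x)) (q : P → M) (x : P) :
    H x →ₗ[ℝ] TangentSpace 𝓘(ℝ, F) (q x) :=
  (mfderiv 𝓘(ℝ, E) 𝓘(ℝ, F) q x).toLinearMap.domRestrict (H x)

/-- The space of two-forms on `T_{q(x)}M` determined by the Levi bracket at `x`: the forms which
correspond, via `T_x q : H_x → T_{q(x)}M`, to the real-valued forms `κ ∘ L_x` on `H_x` obtained by
composing the `Q_x`-valued form `L_x` with linear functionals `κ` on `Q_x = T_xP / H_x`. -/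
def leviForms (H : (x : P) → Submodule ℝ (TangentSpace 𝓘(ℝ, E) x)) (q : P → M) (x : P) :
    Submodule ℝ (TangentSpace 𝓘(ℝ, F) (q x) [⋀^Fin 2]→L[ℝ] ℝ) where
  carrier := {φ | ∃ κ : Module.Dual ℝ (TangentSpace 𝓘(ℝ, E) x ⧸ H x), ∀ v w : H x,
    φ ![tangentRestrict (F := F) H q x v, tangentRestrict (F := F) H q x w] = κ (leviBracket H x v w)}
  zero_mem' := ⟨0, fun v w => by simp⟩
  add_mem' := by
    rintro φ ψ ⟨κ, hκ⟩ ⟨μ, hμ⟩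
    exact ⟨κ + μ, fun v w => by simp [hκ, hμ]⟩
  smul_mem' := by
    rintro c φ ⟨κ, hκ⟩
    exact ⟨c • κ, fun v w => by simp [hκ]⟩

end Contact_Quotients

end

/-! The line of `ξ` is complementary to the hyperplane `H` and is the kernel of `Tq`, so `Tq` is an
isomorphism on `H`. The same splitting determines `α`: zero on `H`, one on `ξ`. It is smooth because
it is constant on a smooth frame (`FormField.isSmoothOn_of_frame`). On sections of `H` the invariant
formula for `dα` reduces to `-α([η, ζ])`, so `dα` restricted to `H` is `-α ∘ L`
(`FormField.d_apply_eq_leviBracket`). As `α` is injective on the line `Q`, non-degeneracy of `L`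
gives the contact condition.

Next, `dα(ξ, ·) = 0`. Pull `α` back along `(t, u) ↦ φ_t(u)`: its coefficient in the time direction
is one, and its coefficient on a vector starting in `H` stays zero along the flow line, so the mixed
component of the exterior derivative vanishes (`FormField.d_apply_of_flow`). A closed two-form
annihilated by the vertical vectors does not change along the fibres, so the form it induces on the
tangent spaces of the base is locally constant on each fibre (`eventually_eq_of_closed_basic`).
Connected fibres make it a well-defined form `ω` (`IsQuotientByField.exists_pullback_eq`). A local
section `σ` of `q` gives `ω = σ^* dα`, whence `ω` is smooth and closed; surjectivity of `q` and `Tq`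
gives uniqueness.

Finally `Q` is a line, so every functional `κ` is a multiple of the one induced by `α`, and the
forms defined by the Levi bracket are the multiples of `ω` (`IsContactForm.leviForms_eq_span`). Thus
`ℓ` is spanned by one global, closed, non-degenerate form. -/

noncomputable section

/-! ### Smooth dependence of linear pullbacks of alternating forms -/

section Pullback_Smooth

variable {E F G : Type*} [NormedAddCommGroup E] [NormedSpace ℝ E]
  [NormedAddCommGroup F] [NormedSpace ℝ F] [NormedAddCommGroup G] [NormedSpace ℝ G] {k : ℕ}

/-- Antisymmetrization of continuous multilinear forms as a continuous linear map. -/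
def alternatizationCLM (E : Type*) [NormedAddCommGroup E] [NormedSpace ℝ E] (k : ℕ) :
    ContinuousMultilinearMap ℝ (fun _ : Fin k => E) ℝ →L[ℝ] E [⋀^Fin k]→L[ℝ] ℝ :=
  LinearMap.mkContinuous
    { toFun := fun f => ContinuousMultilinearMap.alternatization f
      map_add' := fun f g => map_add _ f g
      map_smul' := fun c f => by
        ext v
        simp [ContinuousMultilinearMap.alternatization_apply_apply, Finset.mul_sum,
          mul_smul_comm] }
    (Fintype.card (Equiv.Perm (Fin k))) fun f => by
      refine ContinuousAlternatingMap.opNorm_le_bound _ (by positivity) fun v => ?_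
      simp only [LinearMap.coe_mk, AddHom.coe_mk,
        ContinuousMultilinearMap.alternatization_apply_apply]
      refine (norm_sum_le _ _).trans ?_
      have h : ∀ σ ∈ (Finset.univ : Finset (Equiv.Perm (Fin k))),
          ‖Equiv.Perm.sign σ • f (v ∘ σ)‖ ≤ ‖f‖ * ∏ i, ‖v i‖ := fun σ _ => by
        have h1 : ‖Equiv.Perm.sign σ • f (v ∘ σ)‖ = ‖f (v ∘ σ)‖ := by
          rcases Int.units_eq_one_or (Equiv.Perm.sign σ) with h | h <;> simp [h, Units.smul_def]
        rw [h1]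
        refine (f.le_opNorm _).trans_eq ?_
        rw [← Equiv.prod_comp σ fun i => ‖v i‖]
        rfl
      refine (Finset.sum_le_card_nsmul _ _ _ h).trans_eq ?_
      simp [mul_assoc]

/-- Each of the `k!` signed permutation terms returns the form itself. Dividing by `k!` thus gives a
continuous linear retraction of multilinear forms onto alternating ones. -/
theorem alternatizationCLM_coe (φ : E [⋀^Fin k]→L[ℝ] ℝ) :
    alternatizationCLM E k φ.toContinuousMultilinearMap = (k.factorial : ℝ) • φ := by
  ext v
  simp only [alternatizationCLM, LinearMap.mkContinuous_apply, LinearMap.coe_mk, AddHom.coe_mk,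
    ContinuousMultilinearMap.alternatization_apply_apply]
  have h : ∀ σ : Equiv.Perm (Fin k),
      Equiv.Perm.sign σ • φ.toContinuousMultilinearMap (v ∘ σ) = φ v := fun σ => by
    have := φ.toAlternatingMap.map_perm v σ
    change Equiv.Perm.sign σ • φ.toAlternatingMap (v ∘ σ) = φ v
    rw [this, smul_smul, Int.units_mul_self, one_smul]
    rfl
  rw [Finset.sum_congr rfl fun σ _ => h σ]
  simp [Fintype.card_perm]

/-- The pullback of an alternating form depends smoothly on the form and on the linear map. -/
theorem contDiff_compContinuousLinearMap {n : WithTop ℕ∞} :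
    ContDiff ℝ n fun p : (F [⋀^Fin k]→L[ℝ] ℝ) × (G →L[ℝ] F) =>
      p.1.compContinuousLinearMap p.2 := by
  have h1 : ContDiff ℝ n fun p : (F [⋀^Fin k]→L[ℝ] ℝ) × (G →L[ℝ] F) =>
      p.1.toContinuousMultilinearMap.compContinuousLinearMap fun _ : Fin k => p.2 := by
    have h2 : ContDiff ℝ n fun m : Fin k → (G →L[ℝ] F) =>
        ContinuousMultilinearMap.compContinuousLinearMapContinuousMultilinear ℝ
          (fun _ : Fin k => G) (fun _ : Fin k => F) ℝ m := ContinuousMultilinearMap.contDiff _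
    have h3 : ContDiff ℝ n fun p : (F [⋀^Fin k]→L[ℝ] ℝ) × (G →L[ℝ] F) => fun _ : Fin k => p.2 :=
      contDiff_pi.2 fun _ => contDiff_snd
    have h4 : ContDiff ℝ n fun φ : F [⋀^Fin k]→L[ℝ] ℝ => φ.toContinuousMultilinearMap :=
      (ContinuousAlternatingMap.toContinuousMultilinearMapLI (𝕜 := ℝ) (E := F) (F := ℝ)
        (ι := Fin k)).contDiff
    exact (h2.comp h3).clm_apply (h4.comp contDiff_fst)
  -- Smoothness is known for the underlying multilinear form; normalized antisymmetrization carries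
  -- it back to alternating forms.
  have h4 := ((((k.factorial : ℝ)⁻¹) • alternatizationCLM G k).contDiff (n := n)).comp h1
  convert h4 using 2 with p
  change _ = (k.factorial : ℝ)⁻¹ • alternatizationCLM G k
    (p.1.compContinuousLinearMap p.2).toContinuousMultilinearMap
  rw [alternatizationCLM_coe, smul_smul, inv_mul_cancel₀ (by positivity), one_smul]

end Pullback_Smooth

/-! ### Pullback to vector spaces, and naturality of the exterior derivative -/

section Forms_Along_Maps

variable {E : Type*} [NormedAddCommGroup E] [NormedSpace ℝ E]
  {M : Type*} [TopologicalSpace M] [ChartedSpace E M]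
  {F : Type*} [NormedAddCommGroup F] [NormedSpace ℝ F]
  {N : Type*} [TopologicalSpace N] [ChartedSpace F N]
  {G : Type*} [NormedAddCommGroup G] [NormedSpace ℝ G]
  {G' : Type*} [NormedAddCommGroup G'] [NormedSpace ℝ G']
  {k : ℕ}

/-- The pullback of a form under a map defined on a normed space. -/
def FormField.along (τ : FormField E M k) (g : G → M) : G → G [⋀^Fin k]→L[ℝ] ℝ := fun y =>
  (τ (g y)).compContinuousLinearMap (mfderiv 𝓘(ℝ, G) 𝓘(ℝ, E) g y)

theorem FormField.along_comp (τ : FormField E M k) {g : G → M} {f : G' → G} {y : G'}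
    (hg : MDifferentiableAt 𝓘(ℝ, G) 𝓘(ℝ, E) g (f y)) (hf : DifferentiableAt ℝ f y) :
    τ.along (g ∘ f) y = (τ.along g (f y)).compContinuousLinearMap (fderiv ℝ f y) := by
  ext v
  simp only [FormField.along, ContinuousAlternatingMap.compContinuousLinearMap_apply]
  rw [mfderiv_comp y hg hf.mdifferentiableAt, mfderiv_eq_fderiv]
  rfl

theorem FormField.along_congr (τ : FormField E M k) {g g' : G → M} {y : G} (h : g =ᶠ[𝓝 y] g') :
    τ.along g y = τ.along g' y := by
  -- The type of `τ (g y)` depends on the point; viewing all fibres as forms on `E` allows `g y` to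
  -- be rewritten.
  let σ : M → E [⋀^Fin k]→L[ℝ] ℝ := τ
  have h1 : (mfderiv 𝓘(ℝ, G) 𝓘(ℝ, E) g y : G →L[ℝ] E) = mfderiv 𝓘(ℝ, G) 𝓘(ℝ, E) g' y :=
    h.mfderiv_eq
  change (σ (g y)).compContinuousLinearMap (mfderiv 𝓘(ℝ, G) 𝓘(ℝ, E) g y : G →L[ℝ] E) = _
  rw [h1, h.eq_of_nhds]
  rfl

variable [IsManifold 𝓘(ℝ, E) ∞ M]

theorem ContMDiffAt.eventually_mdifferentiableAt {g : G → M} {a : G}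
    (hg : ContMDiffAt 𝓘(ℝ, G) 𝓘(ℝ, E) ∞ g a) :
    ∀ᶠ y in 𝓝 a, MDifferentiableAt 𝓘(ℝ, G) 𝓘(ℝ, E) g y := by
  have : IsManifold 𝓘(ℝ, E) 1 M := IsManifold.of_le (n := ∞) (WithTop.coe_le_coe.2 le_top)
  -- Regularity of finite order at a point spreads to a neighbourhood; order `∞` need not, hence the
  -- passage to order one.
  have h1 : ContMDiffAt 𝓘(ℝ, G) 𝓘(ℝ, E) 1 g a := hg.of_le (WithTop.coe_le_coe.2 le_top)
  filter_upwards [(contMDiffAt_iff_contMDiffAt_nhds (by simp)).1 h1] with y hy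
  exact hy.mdifferentiableAt (by simp)

omit [IsManifold 𝓘(ℝ, E) ∞ M] in
theorem contMDiffAt_extChartAt_symm_self (x : M) :
    ContMDiffAt 𝓘(ℝ, E) 𝓘(ℝ, E) ∞ (extChartAt 𝓘(ℝ, E) x).symm (extChartAt 𝓘(ℝ, E) x x) := by
  have := contMDiffWithinAt_extChartAt_symm_range_self (n := ∞) (I := 𝓘(ℝ, E)) x
  simpa [contMDiffWithinAt_univ] using this

omit [IsManifold 𝓘(ℝ, E) ∞ M] in
theorem ContMDiffAt.contDiffAt_extChartAt_comp {g : G → M} {a : G}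
    (hg : ContMDiffAt 𝓘(ℝ, G) 𝓘(ℝ, E) ∞ g a) :
    ContDiffAt ℝ ∞ (extChartAt 𝓘(ℝ, E) (g a) ∘ g) a :=
  (contMDiffAt_extChartAt.comp a hg).contDiffAt

/-- Near a point, the pullback of a form is computed in the chart at the image point. -/
theorem FormField.along_eventuallyEq (τ : FormField E M k) {g : G → M} {a : G}
    (hg : ContMDiffAt 𝓘(ℝ, G) 𝓘(ℝ, E) ∞ g a) :
    τ.along g =ᶠ[𝓝 a] fun y => (τ.inChart (g a) (extChartAt 𝓘(ℝ, E) (g a) (g y))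
      ).compContinuousLinearMap (fderiv ℝ (extChartAt 𝓘(ℝ, E) (g a) ∘ g) y) := by
  have h1 : ∀ᶠ y in 𝓝 a, g y ∈ (extChartAt 𝓘(ℝ, E) (g a)).source :=
    hg.continuousAt (extChartAt_source_mem_nhds (g a))
  have h2 := (contMDiffAt_extChartAt_symm_self (E := E) (g a)).eventually_mdifferentiableAt
  have hψ := hg.contDiffAt_extChartAt_comp
  have h3 := hψ.continuousAt.eventually h2
  have h4 : ∀ᶠ y in 𝓝 a, DifferentiableAt ℝ (extChartAt 𝓘(ℝ, E) (g a) ∘ g) y := by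
    filter_upwards [(hψ.of_le (show (1 : WithTop ℕ∞) ≤ ∞ from
      WithTop.coe_le_coe.2 le_top)).eventually (by simp)] with y hy
    exact hy.differentiableAt (by simp)
  filter_upwards [eventually_eventually_nhds.2 h1, h3, h4] with y hy1 hy3 hy4
  have h5 : g =ᶠ[𝓝 y] (extChartAt 𝓘(ℝ, E) (g a)).symm ∘ (extChartAt 𝓘(ℝ, E) (g a) ∘ g) := by
    filter_upwards [hy1] with z hz
    exact ((extChartAt 𝓘(ℝ, E) (g a)).left_inv hz).symm
  rw [τ.along_congr h5, τ.along_comp hy3 hy4]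
  rfl

/-- Smoothness of a form at a point. -/
def FormField.SmoothAt (τ : FormField E M k) (x : M) : Prop :=
  ContDiffAt ℝ ∞ (τ.inChart x) (extChartAt 𝓘(ℝ, E) x x)

/-- The chart formula expresses the pullback through the coefficients of `τ` and the derivative of
`g` in coordinates, both smooth. -/
theorem FormField.SmoothAt.along {τ : FormField E M k} {g : G → M} {a : G}
    (hτ : τ.SmoothAt (g a)) (hg : ContMDiffAt 𝓘(ℝ, G) 𝓘(ℝ, E) ∞ g a) :
    ContDiffAt ℝ ∞ (τ.along g) a := by
  refine ContDiffAt.congr_of_eventuallyEq ?_ (τ.along_eventuallyEq hg)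
  have hψ := hg.contDiffAt_extChartAt_comp
  have h1 : ContDiffAt ℝ ∞ (fderiv ℝ (extChartAt 𝓘(ℝ, E) (g a) ∘ g)) a :=
    hψ.fderiv_right (by simp)
  exact contDiff_compContinuousLinearMap.contDiffAt.comp a
    ((ContDiffAt.comp a (f := extChartAt 𝓘(ℝ, E) (g a) ∘ g) (g := τ.inChart (g a)) hτ hψ).prodMk h1)

/-- The exterior derivative commutes with pullbacks. -/
theorem FormField.SmoothAt.extDeriv_along {τ : FormField E M k} {g : G → M} {a : G}
    (hτ : τ.SmoothAt (g a)) (hg : ContMDiffAt 𝓘(ℝ, G) 𝓘(ℝ, E) ∞ g a) :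
    extDeriv (τ.along g) a = τ.d.along g a := by
  have hψ := hg.contDiffAt_extChartAt_comp
  rw [(τ.along_eventuallyEq hg).extDeriv_eq]
  have h1 := extDeriv_pullback (f := extChartAt 𝓘(ℝ, E) (g a) ∘ g) (x := a)
    (ContDiffAt.differentiableAt hτ (by simp)) hψ
    (by simp; exact WithTop.coe_le_coe.2 le_top)
  refine h1.trans ?_
  ext v
  simp only [FormField.along, FormField.d, ContinuousAlternatingMap.compContinuousLinearMap_apply]
  have h2 := mfderiv_comp a (g := extChartAt 𝓘(ℝ, E) (g a)) (f := g) (I := 𝓘(ℝ, G))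
    (I' := 𝓘(ℝ, E)) (I'' := 𝓘(ℝ, E))
    (contMDiffAt_extChartAt (n := ∞)|>.mdifferentiableAt (by simp)) (hg.mdifferentiableAt (by simp))
  rw [mfderiv_eq_fderiv] at h2
  rw [h2]
  rfl

/-- In the chart at a point near which a form is smooth, its exterior derivative is the exterior
derivative of its coordinate expression. -/
theorem FormField.inChart_d_eventuallyEq {τ : FormField E M k} {x : M}
    (hτ : ∀ᶠ y in 𝓝 x, τ.SmoothAt y) :
    τ.d.inChart x =ᶠ[𝓝 (extChartAt 𝓘(ℝ, E) x x)] extDeriv (τ.inChart x) := by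
  have h1 : ∀ᶠ y in 𝓝 (extChartAt 𝓘(ℝ, E) x x), y ∈ (extChartAt 𝓘(ℝ, E) x).target := by
    exact extChartAt_target_mem_nhds x
  have hc : ContinuousAt (extChartAt 𝓘(ℝ, E) x).symm (extChartAt 𝓘(ℝ, E) x x) :=
    continuousAt_extChartAt_symm x
  have h2 : ∀ᶠ y in 𝓝 (extChartAt 𝓘(ℝ, E) x x), τ.SmoothAt ((extChartAt 𝓘(ℝ, E) x).symm y) := by
    refine hc.eventually ?_
    rwa [extChartAt_to_inv x]
  filter_upwards [h2, h1] with y hy2 hy1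
  have h3 : ContMDiffAt 𝓘(ℝ, E) 𝓘(ℝ, E) ∞ (extChartAt 𝓘(ℝ, E) x).symm y :=
    (contMDiffOn_extChartAt_symm x).contMDiffAt
      ((isOpen_extChartAt_target x).mem_nhds hy1)
  -- `τ.inChart x` is by definition the pullback along the inverse chart, so naturality compares the
  -- derivative taken in this one chart with those taken in the chart at each nearby point.
  exact (hy2.extDeriv_along h3).symm

theorem FormField.SmoothAt.d {τ : FormField E M k} {x : M} (hτ : ∀ᶠ y in 𝓝 x, τ.SmoothAt y) :
    τ.d.SmoothAt x := by
  refine ContDiffAt.congr_of_eventuallyEq ?_ (FormField.inChart_d_eventuallyEq hτ)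
  have h1 : ContDiffAt ℝ ∞ (fderiv ℝ (τ.inChart x)) (extChartAt 𝓘(ℝ, E) x x) :=
    ContDiffAt.fderiv_right (m := ∞) (n := ∞) hτ.self_of_nhds (by simp)
  exact (ContinuousAlternatingMap.alternatizeUncurryFinCLM ℝ E ℝ).contDiff.contDiffAt.comp _ h1

theorem FormField.IsSmoothOn.d {τ : FormField E M k} (hτ : τ.IsSmoothOn univ) :
    τ.d.IsSmoothOn univ := fun _ _ =>
  FormField.SmoothAt.d (Eventually.of_forall fun y => hτ y (mem_univ y))

theorem FormField.IsSmoothOn.d_d {τ : FormField E M k} (hτ : τ.IsSmoothOn univ) : τ.d.d = 0 := by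
  funext x
  have h1 := FormField.inChart_d_eventuallyEq (x := x)
    (Eventually.of_forall fun y => hτ y (mem_univ y))
  have h2 : extDeriv (extDeriv (τ.inChart x)) (extChartAt 𝓘(ℝ, E) x x) = 0 :=
    extDeriv_extDeriv_apply (hτ x (mem_univ x)) (by simp; exact WithTop.coe_le_coe.2 le_top)
  unfold FormField.d at h1 ⊢
  rw [h1.extDeriv_eq, h2]
  ext v
  rfl

end Forms_Along_Maps

/-! ### Vector fields in charts and the formula for `dα` on two fields -/

section Fields_In_Charts

variable {E : Type*} [NormedAddCommGroup E] [NormedSpace ℝ E]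
  {M : Type*} [TopologicalSpace M] [ChartedSpace E M]
  {k : ℕ}

/-- The coordinate expression of a vector field in the preferred chart at `x`. -/
def fieldInChart (X : (y : M) → TangentSpace 𝓘(ℝ, E) y) (x : M) : E → E :=
  mpullbackWithin 𝓘(ℝ, E) 𝓘(ℝ, E) (extChartAt 𝓘(ℝ, E) x).symm X (range 𝓘(ℝ, E))

variable [IsManifold 𝓘(ℝ, E) ∞ M]

theorem contMDiffAt_extChartAt_symm_of_mem {x : M} {y : E}
    (hy : y ∈ (extChartAt 𝓘(ℝ, E) x).target) :
    ContMDiffAt 𝓘(ℝ, E) 𝓘(ℝ, E) ∞ (extChartAt 𝓘(ℝ, E) x).symm y :=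
  (contMDiffOn_extChartAt_symm x).contMDiffAt ((isOpen_extChartAt_target x).mem_nhds hy)

/-- `fieldInChart` applies the inverse of this derivative, which is invertible on the whole chart
target. -/
theorem mfderiv_fieldInChart (X : (y : M) → TangentSpace 𝓘(ℝ, E) y) {x : M} {y : E}
    (hy : y ∈ (extChartAt 𝓘(ℝ, E) x).target) :
    mfderiv 𝓘(ℝ, E) 𝓘(ℝ, E) (extChartAt 𝓘(ℝ, E) x).symm y (fieldInChart (E := E) X x y)
      = X ((extChartAt 𝓘(ℝ, E) x).symm y) := by
  have : IsManifold 𝓘(ℝ, E) 1 M := IsManifold.of_le (n := ∞) (WithTop.coe_le_coe.2 le_top)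
  have h1 := isInvertible_mfderivWithin_extChartAt_symm (I := 𝓘(ℝ, E)) hy
  have h2 : mfderivWithin 𝓘(ℝ, E) 𝓘(ℝ, E) (extChartAt 𝓘(ℝ, E) x).symm (range 𝓘(ℝ, E)) y
      = mfderiv 𝓘(ℝ, E) 𝓘(ℝ, E) (extChartAt 𝓘(ℝ, E) x).symm y := by
    rw [modelWithCornersSelf_coe, range_id, mfderivWithin_univ]
  rw [← h2]
  obtain ⟨e, he⟩ := h1
  have h3 : fieldInChart (E := E) X x y = (mfderivWithin 𝓘(ℝ, E) 𝓘(ℝ, E)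
      (extChartAt 𝓘(ℝ, E) x).symm (range 𝓘(ℝ, E)) y).inverse
        (X ((extChartAt 𝓘(ℝ, E) x).symm y)) := rfl
  rw [h3, ← he, ContinuousLinearMap.inverse_equiv]
  exact e.apply_symm_apply _

omit [IsManifold 𝓘(ℝ, E) ∞ M] in
theorem FormField.inChart_apply (τ : FormField E M k) (x : M) (y : E) (v : Fin k → E) :
    τ.inChart x y v = τ ((extChartAt 𝓘(ℝ, E) x).symm y)
      fun i => mfderiv 𝓘(ℝ, E) 𝓘(ℝ, E) (extChartAt 𝓘(ℝ, E) x).symm y (v i) := rfl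

theorem FormField.inChart_fieldInChart (τ : FormField E M k)
    (X : Fin k → (y : M) → TangentSpace 𝓘(ℝ, E) y) {x : M} {y : E}
    (hy : y ∈ (extChartAt 𝓘(ℝ, E) x).target) :
    τ.inChart x y (fun i => fieldInChart (X i) x y)
      = τ ((extChartAt 𝓘(ℝ, E) x).symm y) fun i => X i ((extChartAt 𝓘(ℝ, E) x).symm y) :=
  (τ.inChart_apply x y _).trans (congrArg _ (funext fun i => mfderiv_fieldInChart (X i) hy))

theorem FormField.inChart_fieldInChart_self (τ : FormField E M k)
    (X : Fin k → (y : M) → TangentSpace 𝓘(ℝ, E) y) (x : M) :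
    τ.inChart x (extChartAt 𝓘(ℝ, E) x x)
      (fun i => fieldInChart (X i) x (extChartAt 𝓘(ℝ, E) x x)) = τ x fun i => X i x := by
  rw [τ.inChart_fieldInChart X (mem_extChartAt_target x)]
  -- The equality of base points cannot be rewritten inside dependent types, so it is eliminated for
  -- a variable point.
  have h : ∀ z, z = x → (τ z fun i => X i z) = τ x fun i => X i x := by rintro _ rfl; rfl
  exact h _ (extChartAt_to_inv x)

omit [IsManifold 𝓘(ℝ, E) ∞ M] in
theorem eventually_extChartAt_symm {x : M} {p : M → Prop} (h : ∀ᶠ z in 𝓝 x, p z) :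
    ∀ᶠ y in 𝓝 (extChartAt 𝓘(ℝ, E) x x),
      y ∈ (extChartAt 𝓘(ℝ, E) x).target ∧ p ((extChartAt 𝓘(ℝ, E) x).symm y) := by
  have hc : ContinuousAt (extChartAt 𝓘(ℝ, E) x).symm (extChartAt 𝓘(ℝ, E) x x) :=
    continuousAt_extChartAt_symm x
  refine Filter.Eventually.and (extChartAt_target_mem_nhds x) (hc.eventually ?_)
  rwa [extChartAt_to_inv x]

variable [FiniteDimensional ℝ E]

theorem contDiffAt_fieldInChart {X : (y : M) → TangentSpace 𝓘(ℝ, E) y} {U : Set M} {x : M}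
    (hX : IsSmoothFieldOn X U) (hU : U ∈ 𝓝 x) :
    ContDiffAt ℝ ∞ (fieldInChart X x) (extChartAt 𝓘(ℝ, E) x x) := by
  have : CompleteSpace E := FiniteDimensional.complete ℝ E
  have h1 := contMDiffWithinAt_mpullbackWithin_extChartAt_symm (n := ∞) (m := ∞)
    (hX.contMDiffAt hU).contMDiffWithinAt uniqueMDiffOn_univ (mem_univ x) (by simp)
  have h2 := contMDiffWithinAt_vectorSpace_iff_contDiffWithinAt.1 h1
  refine h2.contDiffAt ?_
  simpa using extChartAt_target_mem_nhds (I := 𝓘(ℝ, E)) x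

omit [FiniteDimensional ℝ E] in
/-- The bracket of vector fields is computed in charts. -/
theorem mlieBracket_eq_fieldInChart (η ζ : (y : M) → TangentSpace 𝓘(ℝ, E) y) (x : M) :
    fieldInChart (E := E) (mlieBracket 𝓘(ℝ, E) η ζ) x (extChartAt 𝓘(ℝ, E) x x)
      = lieBracket ℝ (fieldInChart η x) (fieldInChart ζ x) (extChartAt 𝓘(ℝ, E) x x) := by
  have : IsManifold 𝓘(ℝ, E) 2 M := IsManifold.of_le (n := ∞) (WithTop.coe_le_coe.2 le_top)
  let a : E := extChartAt 𝓘(ℝ, E) x x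
  let A : E →L[ℝ] TangentSpace 𝓘(ℝ, E) x :=
    (mfderiv 𝓘(ℝ, E) 𝓘(ℝ, E) (extChartAt 𝓘(ℝ, E) x) x).inverse
  have hA : ∀ X : (y : M) → TangentSpace 𝓘(ℝ, E) y, A (fieldInChart X x a) = X x := fun X => by
    have h1 := mfderiv_extChartAt_inverse_comp_mfderivWithin_extChartAT_symm (I := 𝓘(ℝ, E)) (x := x)
      (X ((extChartAt 𝓘(ℝ, E) x).symm a) : E)
    have h2 : ∀ z, z = x → (X z : E) = X x := by rintro _ rfl; rfl
    exact h1.trans (h2 _ (extChartAt_to_inv x))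
  have hinj : Function.Injective A := by
    obtain ⟨e, he⟩ := isInvertible_mfderiv_extChartAt (I := 𝓘(ℝ, E)) (mem_extChartAt_source x)
    simp only [A, ← he, ContinuousLinearMap.inverse_equiv]
    exact e.symm.injective
  refine hinj ((hA _).trans ?_)
  rw [← mlieBracketWithin_univ, mlieBracketWithin_apply]
  have h3 : (extChartAt 𝓘(ℝ, E) x).symm ⁻¹' univ ∩ range 𝓘(ℝ, E) = univ := by simp
  rw [h3]
  exact congrArg A (congrFun (lieBracketWithin_univ (V := fieldInChart η x)
    (W := fieldInChart ζ x)) a)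

/-- For two fields on which a one-form is locally constant, its exterior derivative is minus
its value on the bracket. -/
theorem FormField.d_apply_eq_neg_mlieBracket {α : FormField E M 1} (hα : α.IsSmoothOn univ)
    {η ζ : (y : M) → TangentSpace 𝓘(ℝ, E) y} {U : Set M} {x : M} (hU : U ∈ 𝓝 x)
    (hη : IsSmoothFieldOn η U) (hζ : IsSmoothFieldOn ζ U)
    {c c' : ℝ} (hαη : ∀ y ∈ U, α y ![η y] = c) (hαζ : ∀ y ∈ U, α y ![ζ y] = c') :
    α.d x ![η x, ζ x] = - α x ![mlieBracket 𝓘(ℝ, E) η ζ x] := by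
  have h1 := FormField.inChart_d_eventuallyEq (x := x)
    (Eventually.of_forall fun y => hα y (mem_univ y))
  have e1 := α.d.inChart_fieldInChart_self ![η, ζ] x
  have e2 := α.inChart_fieldInChart_self ![mlieBracket 𝓘(ℝ, E) η ζ] x
  -- In the chart, `dα(η, ζ) = η(α(ζ)) - ζ(α(η)) - α([η, ζ])`; the first two terms are derivatives
  -- of constants and vanish by `hconst`.
  have e3 := extDeriv_apply_vectorField (x := extChartAt 𝓘(ℝ, E) x x)
    (V := ![fieldInChart η x, fieldInChart ζ x])
    (ContDiffAt.differentiableAt (hα x (mem_univ x)) (by simp)) (by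
      intro i
      fin_cases i
      · exact (contDiffAt_fieldInChart hη hU).differentiableAt (by simp)
      · exact (contDiffAt_fieldInChart hζ hU).differentiableAt (by simp))
  have hconst : ∀ (X : (y : M) → TangentSpace 𝓘(ℝ, E) y) (c : ℝ), (∀ y ∈ U, α y ![X y] = c) →
      fderiv ℝ (fun y => α.inChart x y ![fieldInChart X x y]) (extChartAt 𝓘(ℝ, E) x x) = 0 := by
    intro X c hX
    have : (fun y => α.inChart x y ![fieldInChart X x y])
        =ᶠ[𝓝 (extChartAt 𝓘(ℝ, E) x x)] fun _ => c := by
      filter_upwards [eventually_extChartAt_symm (E := E) hU] with y hy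
      rw [← hX _ hy.2]
      have := α.inChart_fieldInChart ![X] hy.1
      simpa [Matrix.vec_single_eq_const, Fin.isValue] using this
    rw [this.fderiv_eq]
    simp
  have f1 : ∀ (X : (y : M) → TangentSpace 𝓘(ℝ, E) y) (Y : E → E) (y : E),
      (Fin.removeNth 0 fun i : Fin 2 => (![Y, fieldInChart X x] : Fin 2 → E → E) i y)
        = ![fieldInChart X x y] := fun X Y y => by
    funext i; fin_cases i; rfl
  have f2 : ∀ (X : (y : M) → TangentSpace 𝓘(ℝ, E) y) (Y : E → E) (y : E),
      (Fin.removeNth 1 fun i : Fin 2 => (![fieldInChart X x, Y] : Fin 2 → E → E) i y)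
        = ![fieldInChart X x y] := fun X Y y => by
    funext i; fin_cases i; rfl
  have f3 : (fun i : Fin 1 => fieldInChart (E := E) (![mlieBracket 𝓘(ℝ, E) η ζ] i) x
      (extChartAt 𝓘(ℝ, E) x x)) = ![lieBracket ℝ (fieldInChart η x) (fieldInChart ζ x)
        (extChartAt 𝓘(ℝ, E) x x)] := by
    funext i; fin_cases i
    exact mlieBracket_eq_fieldInChart η ζ x
  have f4 : (fun i : Fin 2 => (![fieldInChart η x, fieldInChart ζ x] : Fin 2 → E → E) i
      (extChartAt 𝓘(ℝ, E) x x)) = fun i : Fin 2 => fieldInChart (E := E) (![η, ζ] i) x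
        (extChartAt 𝓘(ℝ, E) x x) := by
    funext i; fin_cases i <;> rfl
  have f5 : (fun i : Fin 2 => (![η, ζ] : Fin 2 → (y : M) → TangentSpace 𝓘(ℝ, E) y) i x)
      = ![η x, ζ x] := by
    funext i; fin_cases i <;> rfl
  have f6 : (fun i : Fin 1 => (![mlieBracket 𝓘(ℝ, E) η ζ] :
      Fin 1 → (y : M) → TangentSpace 𝓘(ℝ, E) y) i x) = ![mlieBracket 𝓘(ℝ, E) η ζ x] := by
    funext i; fin_cases i; rfl
  rw [f6] at e2
  rw [f5, h1.eq_of_nhds, ← f4, e3] at e1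
  rw [← e1, ← e2, f3, Fin.sum_univ_two]
  simp only [f1, f2, hconst η c hαη, hconst ζ c' hαζ]
  simp
  congr 1
  funext i; fin_cases i; rfl


end Fields_In_Charts

/-! ### Linear algebra of a hyperplane and a transversal vector -/

section Hyperplanes

variable {V : Type*} [AddCommGroup V] [Module ℝ V] [FiniteDimensional ℝ V]

/-- Adjoining `e` strictly raises the dimension of a hyperplane, so `H` and `e` span `V`. -/
theorem exists_sub_smul_mem_of_finrank {H : Submodule ℝ V} {m : ℕ}
    (hV : Module.finrank ℝ V = m + 1) (hH : Module.finrank ℝ H = m) {e : V} (he : e ∉ H) (v : V) :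
    ∃ c : ℝ, v - c • e ∈ H := by
  have h1 : H < H ⊔ Submodule.span ℝ {e} := by
    refine lt_of_le_of_ne le_sup_left fun h => he ?_
    rw [h]
    exact Submodule.mem_sup_right (Submodule.mem_span_singleton_self e)
  have h2 := Submodule.finrank_lt_finrank_of_lt h1
  have h3 : H ⊔ Submodule.span ℝ {e} = ⊤ := by
    refine Submodule.eq_top_of_finrank_eq (le_antisymm (Submodule.finrank_le _) ?_)
    omega
  obtain ⟨h, hh, w, hw, hv⟩ := Submodule.mem_sup.1 (h3 ▸ Submodule.mem_top : v ∈ _)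
  obtain ⟨c, rfl⟩ := Submodule.mem_span_singleton.1 hw
  exact ⟨c, by rw [← hv, add_sub_cancel_right]; exact hh⟩

/-- A functional killing `H` but not `e` is normalized at `e`. Its kernel is no larger than `H`,
because a vector `h + c • e` in the kernel has `c = 0`. -/
theorem exists_dual_ker_eq_of_finrank {H : Submodule ℝ V} {m : ℕ}
    (hV : Module.finrank ℝ V = m + 1) (hH : Module.finrank ℝ H = m) {e : V} (he : e ∉ H) :
    ∃ f : V →ₗ[ℝ] ℝ, f e = 1 ∧ ∀ v, f v = 0 ↔ v ∈ H := by
  obtain ⟨g, hge, hgH⟩ := Submodule.exists_le_ker_of_notMem he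
  have h0 : ∀ v ∈ H, g v = 0 := fun v hv => hgH hv
  refine ⟨(g e)⁻¹ • g, by simp [hge], fun v => ?_⟩
  constructor
  · intro hv
    have hv' : g v = 0 := by simpa [hge] using hv
    obtain ⟨c, hc⟩ := exists_sub_smul_mem_of_finrank hV hH he v
    have h1 := h0 _ hc
    rw [map_sub, map_smul, hv', zero_sub, neg_eq_zero, smul_eq_mul] at h1
    have h2 : c = 0 := by simpa [hge] using h1
    simpa [h2] using hc
  · intro hv
    simp [h0 v hv]

end Hyperplanes

/-! ### Alternating one- and two-forms as linear and bilinear maps -/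

section Alternating_Forms

variable {V : Type*} [AddCommGroup V] [Module ℝ V] [TopologicalSpace V]

/-- An alternating one-form as a linear functional. -/
def ContinuousAlternatingMap.toFunctional (φ : V [⋀^Fin 1]→L[ℝ] ℝ) : V →ₗ[ℝ] ℝ where
  toFun v := φ ![v]
  map_add' v w := φ.vecCons_add _ v w
  map_smul' c v := φ.vecCons_smul _ c v

theorem ContinuousAlternatingMap.toFunctional_apply (φ : V [⋀^Fin 1]→L[ℝ] ℝ) (v : V) :
    φ.toFunctional v = φ ![v] := rfl

omit [AddCommGroup V] [Module ℝ V] [TopologicalSpace V] in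
theorem update_vec_two (v u w : V) : Function.update ![v, u] 1 w = ![v, w] := by
  funext i; fin_cases i <;> simp

/-- An alternating two-form as a bilinear form. -/
def ContinuousAlternatingMap.toBilin (φ : V [⋀^Fin 2]→L[ℝ] ℝ) : V →ₗ[ℝ] V →ₗ[ℝ] ℝ :=
  LinearMap.mk₂ ℝ (fun v w => φ ![v, w]) (fun v v' w => φ.vecCons_add _ v v')
    (fun c v w => φ.vecCons_smul _ c v)
    (fun v w w' => by
      have := φ.toAlternatingMap.map_update_add ![v, 0] 1 w w'
      rwa [update_vec_two, update_vec_two, update_vec_two] at this)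
    (fun c v w => by
      have := φ.toAlternatingMap.map_update_smul ![v, 0] 1 c w
      rwa [update_vec_two, update_vec_two] at this)

theorem ContinuousAlternatingMap.toBilin_apply (φ : V [⋀^Fin 2]→L[ℝ] ℝ) (v w : V) :
    φ.toBilin v w = φ ![v, w] := rfl

theorem ContinuousAlternatingMap.apply_self (φ : V [⋀^Fin 2]→L[ℝ] ℝ) (v : V) : φ ![v, v] = 0 :=
  φ.map_eq_zero_of_eq ![v, v] (i := 0) (j := 1) rfl (by simp)

theorem ContinuousAlternatingMap.apply_swap (φ : V [⋀^Fin 2]→L[ℝ] ℝ) (v w : V) :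
    φ ![v, w] = - φ ![w, v] := by
  have h := φ.apply_self (v + w)
  rw [← φ.toBilin_apply] at h
  simp only [map_add, LinearMap.add_apply, φ.toBilin_apply, φ.apply_self] at h
  linarith

end Alternating_Forms

/-! ### Smoothness of a one-form from its values on a frame -/

section One_Forms

variable {E : Type*} [NormedAddCommGroup E] [NormedSpace ℝ E] [FiniteDimensional ℝ E]
  {P : Type*} [TopologicalSpace P] [ChartedSpace E P] [IsManifold 𝓘(ℝ, E) ∞ P]

/-- A one-form which takes constant values on a smooth frame is smooth. -/
theorem FormField.isSmoothOn_of_frame {H : (x : P) → Submodule ℝ (TangentSpace 𝓘(ℝ, E) x)} {m : ℕ}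
    (hE : Module.finrank ℝ E = m + 1) (hH : IsSmoothDistribution H m)
    {ξ : (x : P) → TangentSpace 𝓘(ℝ, E) x} (hξ : IsSmoothFieldOn ξ univ)
    {α : FormField E P 1} (hα : ∀ x, ∀ v ∈ H x, α x ![v] = 0) (hαξ : ∀ x, α x ![ξ x] = 1) :
    α.IsSmoothOn univ := by
  intro x _
  obtain ⟨U, hU, hxU, s, hs, hsU⟩ := hH x
  let a : E := extChartAt 𝓘(ℝ, E) x x
  -- The frame of `H` completed by `ξ`, assembled into an operator from coefficients to vectors; the
  -- last coefficient is that of `ξ`.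
  let T : E → ((Fin m → ℝ) × ℝ) →L[ℝ] E := fun y =>
    (∑ i, ((ContinuousLinearMap.proj (R := ℝ) (φ := fun _ : Fin m => ℝ) i).comp
      (ContinuousLinearMap.fst ℝ (Fin m → ℝ) ℝ)).smulRight (fieldInChart (s i) x y)) +
    (ContinuousLinearMap.snd ℝ (Fin m → ℝ) ℝ).smulRight (fieldInChart ξ x y)
  have hTapp : ∀ y w, T y w = ∑ i, w.1 i • fieldInChart (E := E) (s i) x y
      + w.2 • fieldInChart (E := E) ξ x y := fun y w => by
    simp [T]
  have hT : ContDiffAt ℝ ∞ T a := by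
    refine ContDiffAt.add (ContDiffAt.sum fun i _ => ?_) ?_
    · exact (ContinuousLinearMap.smulRightL ℝ ((Fin m → ℝ) × ℝ) E _).contDiff.contDiffAt.comp a
        (contDiffAt_fieldInChart (hs i) (hU.mem_nhds hxU))
    · exact (ContinuousLinearMap.smulRightL ℝ ((Fin m → ℝ) × ℝ) E _).contDiff.contDiffAt.comp a
        (contDiffAt_fieldInChart hξ univ_mem)
  have hval : ∀ y ∈ (extChartAt 𝓘(ℝ, E) x).target, ∀ w,
      mfderiv 𝓘(ℝ, E) 𝓘(ℝ, E) (extChartAt 𝓘(ℝ, E) x).symm y (T y w)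
        = ∑ i, w.1 i • s i ((extChartAt 𝓘(ℝ, E) x).symm y)
          + w.2 • ξ ((extChartAt 𝓘(ℝ, E) x).symm y) := by
    intro y hy w
    rw [hTapp]
    refine (map_add _ _ _).trans (congrArg₂ _ ((map_sum _ _ _).trans ?_) ?_)
    · exact Finset.sum_congr rfl fun i _ => (map_smul _ _ _).trans
        (congrArg _ (mfderiv_fieldInChart (s i) hy))
    · exact (map_smul _ _ _).trans (congrArg _ (mfderiv_fieldInChart ξ hy))
  have hmem : ∀ z ∈ U, ∀ c : Fin m → ℝ, ∑ i, c i • s i z ∈ H z := fun z hz c =>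
    Submodule.sum_mem _ fun i _ => Submodule.smul_mem _ _ (by
      rw [(hsU z hz).2]; exact Submodule.subset_span ⟨i, rfl⟩)
  have hαT : ∀ y ∈ (extChartAt 𝓘(ℝ, E) x).target, (extChartAt 𝓘(ℝ, E) x).symm y ∈ U → ∀ w,
      α.inChart x y ![T y w] = w.2 := by
    intro y hy hyU w
    have h1 : α.inChart x y ![T y w] = (α ((extChartAt 𝓘(ℝ, E) x).symm y)).toFunctional
        (mfderiv 𝓘(ℝ, E) 𝓘(ℝ, E) (extChartAt 𝓘(ℝ, E) x).symm y (T y w)) := by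
      rw [FormField.inChart_apply, ContinuousAlternatingMap.toFunctional_apply]
      exact congrArg _ (funext fun i => by fin_cases i; rfl)
    rw [h1, hval y hy w, map_add, map_smul, ContinuousAlternatingMap.toFunctional_apply,
      ContinuousAlternatingMap.toFunctional_apply, hα _ _ (hmem _ hyU w.1), hαξ]
    simp
  -- Applying `α` isolates the coefficient of `ξ`; the remaining ones vanish by independence of the
  -- frame of `H`.
  have hinj : Function.Injective (T a) := by
    rw [injective_iff_map_eq_zero]
    intro w hw
    have hat : a ∈ (extChartAt 𝓘(ℝ, E) x).target := mem_extChartAt_target x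
    have haU : (extChartAt 𝓘(ℝ, E) x).symm a ∈ U := by
      have : (extChartAt 𝓘(ℝ, E) x).symm a = x := extChartAt_to_inv x
      rwa [this]
    have h1 := hval a hat w
    have h2 := hαT a hat haU w
    rw [hw] at h1 h2
    have h3 : w.2 = 0 := by
      rw [← h2]
      exact (α.inChart x a).map_coord_zero 0 rfl
    rw [h3, zero_smul, add_zero] at h1
    have h4 := Fintype.linearIndependent_iff.1 (hsU _ haU).1 w.1 (h1.symm.trans (map_zero _))
    exact Prod.ext (funext h4) h3
  let e : ((Fin m → ℝ) × ℝ) ≃L[ℝ] E :=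
    ((T a : ((Fin m → ℝ) × ℝ) →ₗ[ℝ] E).linearEquivOfInjective hinj
      (by simp [hE])).toContinuousLinearEquiv
  have he : (e : ((Fin m → ℝ) × ℝ) →L[ℝ] E) = T a := by
    exact ContinuousLinearMap.ext fun w => rfl
  have hinv : ContDiffAt ℝ ∞ (fun y => ContinuousLinearMap.inverse (T y)) a := by
    have h1 : ContDiffAt ℝ ∞ ContinuousLinearMap.inverse (T a) := he ▸ contDiffAt_map_inverse e
    exact h1.comp a hT
  have hev : ∀ᶠ y in 𝓝 a, T y ∈ range ((↑) : (((Fin m → ℝ) × ℝ) ≃L[ℝ] E) → _) :=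
    hT.continuousAt (he ▸ ContinuousLinearEquiv.nhds e)
  -- `α` reads off the coefficient of `ξ`, so it is the last component of `(T y)⁻¹`; inversion of
  -- operators is smooth.
  have key : α.inChart x =ᶠ[𝓝 a] fun y =>
      ContinuousAlternatingMap.ofSubsingletonLIE (𝕜 := ℝ) (E := E) (F := ℝ) (0 : Fin 1)
        ((ContinuousLinearMap.snd ℝ (Fin m → ℝ) ℝ).comp (ContinuousLinearMap.inverse (T y))) := by
    filter_upwards [hev, eventually_extChartAt_symm (E := E) (hU.mem_nhds hxU)] with y ⟨e', he'⟩ hy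
    rw [← he', ContinuousLinearMap.inverse_equiv]
    ext v
    have h1 := hαT y hy.1 hy.2 (e'.symm (v 0))
    rw [← he'] at h1
    have h2 : v = ![v 0] := by funext i; fin_cases i; rfl
    rw [h2]
    simpa using h1
  refine ContDiffAt.congr_of_eventuallyEq ?_ key
  exact (LinearIsometryEquiv.contDiff _).contDiffAt.comp a (contDiffAt_const.clm_comp hinv)

end One_Forms

/-! ### Derivatives along lines -/

section Directional_Derivatives

variable {G : Type*} [NormedAddCommGroup G] [NormedSpace ℝ G]

/-- A directional derivative sees only the line. This matters for the flow, where one coefficient is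
controlled only along a single flow line. -/
theorem fderiv_apply_eq_zero_of_eventually_const {f : G → ℝ} {p e : G} {c : ℝ}
    (hf : DifferentiableAt ℝ f p) (h : ∀ᶠ t : ℝ in 𝓝 0, f (p + t • e) = c) :
    fderiv ℝ f p e = 0 := by
  rw [← hf.lineDeriv_eq_fderiv, lineDeriv]
  have h1 : (fun t : ℝ => f (p + t • e)) =ᶠ[𝓝 0] fun _ => c := h
  rw [h1.deriv_eq, deriv_const]

theorem extDeriv_one_form_apply {β : G → G [⋀^Fin 1]→L[ℝ] ℝ} {p : G}
    (hβ : DifferentiableAt ℝ β p) (v w : G) :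
    extDeriv β p ![v, w] = fderiv ℝ (fun y => β y ![w]) p v - fderiv ℝ (fun y => β y ![v]) p w := by
  rw [extDeriv_apply hβ, Fin.sum_univ_two]
  have h0 : Fin.removeNth 0 ![v, w] = ![w] := by funext i; fin_cases i; rfl
  have h1 : Fin.removeNth 1 ![v, w] = ![v] := by funext i; fin_cases i; rfl
  rw [h0, h1]
  simp [sub_eq_add_neg]

theorem DifferentiableAt.alternating_apply {k : ℕ} {β : G → G [⋀^Fin k]→L[ℝ] ℝ} {p : G}
    (hβ : DifferentiableAt ℝ β p) (v : Fin k → G) : DifferentiableAt ℝ (fun y => β y v) p :=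
  ((ContinuousAlternatingMap.apply ℝ G ℝ v).differentiableAt.comp p hβ)

end Directional_Derivatives

/-! ### Contraction of `dα` with a field whose flow preserves `H` -/

section Flow

variable {E : Type*} [NormedAddCommGroup E] [NormedSpace ℝ E]
  {P : Type*} [TopologicalSpace P] [ChartedSpace E P]
  {G : Type*} [NormedAddCommGroup G] [NormedSpace ℝ G]
  {G' : Type*} [NormedAddCommGroup G'] [NormedSpace ℝ G']

theorem mfderiv_comp_fderiv_apply {g : G → P} {f : G' → G} {y : G'}
    (hg : MDifferentiableAt 𝓘(ℝ, G) 𝓘(ℝ, E) g (f y)) (hf : DifferentiableAt ℝ f y) (v : G') :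
    mfderiv 𝓘(ℝ, G') 𝓘(ℝ, E) (g ∘ f) y v = mfderiv 𝓘(ℝ, G) 𝓘(ℝ, E) g (f y) (fderiv ℝ f y v) := by
  rw [mfderiv_comp y hg hf.mdifferentiableAt, mfderiv_eq_fderiv]
  rfl

theorem FormField.along_apply {k : ℕ} (τ : FormField E P k) (g : G → P) (y : G) (v : Fin k → G) :
    τ.along g y v = τ (g y) fun i => mfderiv 𝓘(ℝ, G) 𝓘(ℝ, E) g y (v i) := rfl

variable [IsManifold 𝓘(ℝ, E) ∞ P]

variable {ξ : (x : P) → TangentSpace 𝓘(ℝ, E) x} {ε : ℝ} {U : Set P} {φ : ℝ → P → P}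

omit [IsManifold 𝓘(ℝ, E) ∞ P] in
theorem IsLocalFlow.contMDiffAt (h : IsLocalFlow ξ ε U φ) {t : ℝ} (ht : t ∈ Ioo (-ε) ε) {y : P}
    (hy : y ∈ U) : ContMDiffAt (𝓘(ℝ, ℝ).prod 𝓘(ℝ, E)) 𝓘(ℝ, E) ∞ (fun p : ℝ × P => φ p.1 p.2)
      (t, y) :=
  h.smooth.contMDiffAt ((isOpen_Ioo.prod h.isOpen).mem_nhds ⟨ht, hy⟩)

omit [IsManifold 𝓘(ℝ, E) ∞ P] in
theorem IsLocalFlow.mdifferentiableAt (h : IsLocalFlow ξ ε U φ) {t : ℝ} (ht : t ∈ Ioo (-ε) ε)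
    {y : P} (hy : y ∈ U) : MDifferentiableAt 𝓘(ℝ, E) 𝓘(ℝ, E) (φ t) y := by
  have h1 : ContMDiffAt 𝓘(ℝ, E) 𝓘(ℝ, E) ∞ (φ t) y :=
    (h.contMDiffAt ht hy).comp (f := fun z : P => (t, z)) y
      (contMDiffAt_const.prodMk contMDiffAt_id)
  exact h1.mdifferentiableAt (by simp)

/-- A local flow as a map defined near `0` in `ℝ × E`, by means of the chart at `x`. -/
def flowInChart (φ : ℝ → P → P) (x : P) : ℝ × E → P := fun p =>
  φ p.1 ((extChartAt 𝓘(ℝ, E) x).symm p.2)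

variable {x : P} {t : ℝ} {u : E}

theorem IsLocalFlow.contMDiffAt_flowInChart (h : IsLocalFlow ξ ε U φ) (ht : t ∈ Ioo (-ε) ε)
    (hu : u ∈ (extChartAt 𝓘(ℝ, E) x).target) (huU : (extChartAt 𝓘(ℝ, E) x).symm u ∈ U) :
    ContMDiffAt 𝓘(ℝ, ℝ × E) 𝓘(ℝ, E) ∞ (flowInChart (E := E) φ x) (t, u) := by
  have h1 : ContMDiffAt 𝓘(ℝ, ℝ × E) 𝓘(ℝ, ℝ) ∞ (fun p : ℝ × E => p.1) (t, u) :=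
    contDiffAt_fst.contMDiffAt
  have h2 : ContMDiffAt 𝓘(ℝ, ℝ × E) 𝓘(ℝ, E) ∞
      (fun p : ℝ × E => (extChartAt 𝓘(ℝ, E) x).symm p.2) (t, u) :=
    (contMDiffAt_extChartAt_symm_of_mem hu).comp (t, u) contDiffAt_snd.contMDiffAt
  exact (h.contMDiffAt ht huU).comp (t, u) (h1.prodMk h2)

theorem IsLocalFlow.mfderiv_flowInChart_fst (h : IsLocalFlow ξ ε U φ) (ht : t ∈ Ioo (-ε) ε)
    (hu : u ∈ (extChartAt 𝓘(ℝ, E) x).target) (huU : (extChartAt 𝓘(ℝ, E) x).symm u ∈ U) :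
    mfderiv 𝓘(ℝ, ℝ × E) 𝓘(ℝ, E) (flowInChart (E := E) φ x) (t, u) ((1 : ℝ), (0 : E))
      = ξ (flowInChart (E := E) φ x (t, u)) := by
  have h1 := (h.contMDiffAt_flowInChart ht hu huU).mdifferentiableAt (by simp)
  have hf : HasFDerivAt (fun s : ℝ => (s, u)) (ContinuousLinearMap.inl ℝ ℝ E) t :=
    hasFDerivAt_prodMk_left t u
  have h2 := mfderiv_comp_fderiv_apply (f := fun s : ℝ => (s, u)) (y := t) h1
    hf.differentiableAt (1 : ℝ)
  have h3 := ((h.integral _ huU t ht).hasMFDerivAt (isOpen_Ioo.mem_nhds ht)).mfderiv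
  rw [hf.fderiv] at h2
  refine h2.symm.trans ?_
  refine (congrArg (fun A : ℝ →L[ℝ] E => A 1) h3).trans (one_smul ℝ _)

theorem IsLocalFlow.mfderiv_flowInChart_snd (h : IsLocalFlow ξ ε U φ) (ht : t ∈ Ioo (-ε) ε)
    (hu : u ∈ (extChartAt 𝓘(ℝ, E) x).target) (huU : (extChartAt 𝓘(ℝ, E) x).symm u ∈ U) (v : E) :
    mfderiv 𝓘(ℝ, ℝ × E) 𝓘(ℝ, E) (flowInChart (E := E) φ x) (t, u) ((0 : ℝ), v)
      = mfderiv 𝓘(ℝ, E) 𝓘(ℝ, E) (φ t ∘ (extChartAt 𝓘(ℝ, E) x).symm) u v := by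
  have h1 := (h.contMDiffAt_flowInChart ht hu huU).mdifferentiableAt (by simp)
  have hf : HasFDerivAt (fun w : E => (t, w)) (ContinuousLinearMap.inr ℝ ℝ E) u :=
    hasFDerivAt_prodMk_right t u
  have h2 := mfderiv_comp_fderiv_apply (f := fun w : E => (t, w)) (y := u) h1
    hf.differentiableAt v
  rw [hf.fderiv] at h2
  exact h2.symm

/-- If the local flow of `ξ` preserves `H` and the one-form `α` vanishes on `H` and takes the value
one on `ξ`, then `dα(ξ, w) = 0` for `w` in `H`. -/
theorem FormField.d_apply_of_flow [FiniteDimensional ℝ E]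
    {H : (x : P) → Submodule ℝ (TangentSpace 𝓘(ℝ, E) x)} {k : ℕ}
    (hH : IsSmoothDistribution H k) {α : FormField E P 1} (hα : α.IsSmoothOn univ)
    (hαH : ∀ x, ∀ v ∈ H x, α x ![v] = 0) (hαξ : ∀ x, α x ![ξ x] = 1)
    (h : IsLocalFlow ξ ε U φ) (hφ : ∀ t ∈ Ioo (-ε) ε, ∀ x ∈ U,
      (H x).map (mfderiv 𝓘(ℝ, E) 𝓘(ℝ, E) (φ t) x).toLinearMap = H (φ t x))
    (hx : x ∈ U) {w : TangentSpace 𝓘(ℝ, E) x} (hw : w ∈ H x) : α.d x ![ξ x, w] = 0 := by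
  -- Only the value of `X` at `x` matters; a field is used so that `w` can be written in the chart
  -- by `fieldInChart`.
  obtain ⟨X, hX⟩ : ∃ X : (y : P) → TangentSpace 𝓘(ℝ, E) y, X x = w := by
    obtain ⟨e, he⟩ := exists_linear_extension hH x
    exact ⟨e ⟨w, hw⟩, (he ⟨w, hw⟩).2⟩
  have h0 : (0 : ℝ) ∈ Ioo (-ε) ε := ⟨neg_lt_zero.2 h.pos, h.pos⟩
  let a : E := extChartAt 𝓘(ℝ, E) x x
  let g : ℝ × E → P := flowInChart φ x
  let v : E := fieldInChart X x a
  have hat : a ∈ (extChartAt 𝓘(ℝ, E) x).target := mem_extChartAt_target x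
  have hax : (extChartAt 𝓘(ℝ, E) x).symm a = x := extChartAt_to_inv x
  have haU : (extChartAt 𝓘(ℝ, E) x).symm a ∈ U := by rwa [hax]
  have hXa : X ((extChartAt 𝓘(ℝ, E) x).symm a) ∈ H ((extChartAt 𝓘(ℝ, E) x).symm a) := by
    have : ∀ z, z = x → X z ∈ H z := by rintro _ rfl; rwa [hX]
    exact this _ hax
  have hga : g (0, a) = x := (h.initial _ haU).trans hax
  have hg : ContMDiffAt 𝓘(ℝ, ℝ × E) 𝓘(ℝ, E) ∞ g (0, a) := h.contMDiffAt_flowInChart h0 hat haU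
  have hαg : α.SmoothAt (g (0, a)) := hα _ (mem_univ _)
  have hβ : DifferentiableAt ℝ (α.along g) (0, a) := (hαg.along hg).differentiableAt (by simp)
  -- This is the time derivative of the coefficient on `v`, minus the derivative along `v` of the
  -- time coefficient. The former coefficient is constantly `0`, as the flow keeps the vector in
  -- `H`; the latter is constantly `1`, as the time direction maps to `ξ`.
  have h1 : extDeriv (α.along g) (0, a) ![((1 : ℝ), (0 : E)), ((0 : ℝ), v)] = 0 := by
    rw [extDeriv_one_form_apply hβ,
      fderiv_apply_eq_zero_of_eventually_const (c := 0) (hβ.alternating_apply _),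
      fderiv_apply_eq_zero_of_eventually_const (c := 1) (hβ.alternating_apply _), sub_zero]
    · have hc : ContinuousAt (fun t : ℝ => a + t • v) 0 := by fun_prop
      have hev : ∀ᶠ u in 𝓝 (a + (0 : ℝ) • v), u ∈ (extChartAt 𝓘(ℝ, E) x).target ∧
          (extChartAt 𝓘(ℝ, E) x).symm u ∈ U := by
        rw [zero_smul, add_zero]
        exact eventually_extChartAt_symm (E := E) (h.isOpen.mem_nhds hx)
      filter_upwards [hc.eventually hev] with s hs
      have e1 : ((0 : ℝ), a) + s • ((0 : ℝ), v) = (0, a + s • v) := by simp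
      rw [e1, α.along_apply]
      refine Eq.trans (congrArg _ (funext fun i => ?_)) (hαξ (g (0, a + s • v)))
      fin_cases i
      exact h.mfderiv_flowInChart_fst h0 hs.1 hs.2
    · filter_upwards [isOpen_Ioo.mem_nhds h0] with s hs
      have e1 : ((0 : ℝ), a) + s • ((1 : ℝ), (0 : E)) = (s, a) := by simp
      rw [e1, α.along_apply]
      have e2 : mfderiv 𝓘(ℝ, ℝ × E) 𝓘(ℝ, E) g (s, a) ((0 : ℝ), v) ∈ H (g (s, a)) := by
        rw [h.mfderiv_flowInChart_snd hs hat haU v, mfderiv_comp a (h.mdifferentiableAt hs haU)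
          ((contMDiffAt_extChartAt_symm_of_mem hat).mdifferentiableAt (by simp))]
        have e3 := hφ s hs _ haU
        change _ ∈ H (φ s ((extChartAt 𝓘(ℝ, E) x).symm a))
        rw [← e3]
        refine Submodule.mem_map.2 ⟨_, hXa, ?_⟩
        exact congrArg _ (mfderiv_fieldInChart X hat).symm
      refine Eq.trans (congrArg _ (funext fun i => ?_)) (hαH _ _ e2)
      fin_cases i
      rfl
  -- The flow at time zero is the identity, so the spatial vector `v` is sent to `w`.
  have h2 : mfderiv 𝓘(ℝ, ℝ × E) 𝓘(ℝ, E) g (0, a) ((0 : ℝ), v) = X (g (0, a)) := by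
    rw [h.mfderiv_flowInChart_snd h0 hat haU v]
    have e1 : φ 0 ∘ (extChartAt 𝓘(ℝ, E) x).symm =ᶠ[𝓝 a] (extChartAt 𝓘(ℝ, E) x).symm := by
      filter_upwards [eventually_extChartAt_symm (E := E) (h.isOpen.mem_nhds hx)] with y hy
      exact h.initial _ hy.2
    have e2 : (mfderiv 𝓘(ℝ, E) 𝓘(ℝ, E) (φ 0 ∘ (extChartAt 𝓘(ℝ, E) x).symm) a : E →L[ℝ] E)
        = mfderiv 𝓘(ℝ, E) 𝓘(ℝ, E) (extChartAt 𝓘(ℝ, E) x).symm a := e1.mfderiv_eq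
    refine (congrArg (fun A : E →L[ℝ] E => A v) e2).trans ?_
    refine (mfderiv_fieldInChart X hat).trans ?_
    have e3 : ∀ z z' : P, z = z' → (X z : E) = X z' := by rintro _ _ rfl; rfl
    exact e3 _ _ (hax.trans hga.symm)
  rw [hαg.extDeriv_along hg, FormField.along_apply] at h1
  have h3 : ∀ z, z = x → α.d z ![ξ z, X z] = α.d x ![ξ x, w] := by rintro _ rfl; rw [hX]
  rw [← h3 _ hga]
  refine Eq.trans ?_ h1
  refine congrArg _ (funext fun i => ?_)
  fin_cases i
  · exact (h.mfderiv_flowInChart_fst h0 hat haU).symm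
  · exact h2.symm

end Flow

/-! ### The normalized contact form -/

section Contact_Forms

variable {E : Type*} [NormedAddCommGroup E] [NormedSpace ℝ E] [FiniteDimensional ℝ E]
  {P : Type*} [TopologicalSpace P] [ChartedSpace E P] [IsManifold 𝓘(ℝ, E) ∞ P]
  {H : (x : P) → Submodule ℝ (TangentSpace 𝓘(ℝ, E) x)} {ξ : (x : P) → TangentSpace 𝓘(ℝ, E) x}
  {α : FormField E P 1} {n : ℕ}

omit [FiniteDimensional ℝ E] in
theorem IsSmoothDistribution.finrank_eq {k : ℕ} (hH : IsSmoothDistribution H k) (x : P) :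
    Module.finrank ℝ (H x) = k := by
  obtain ⟨U, hU, hxU, s, hs, hsU⟩ := hH x
  rw [(hsU x hxU).2, finrank_span_eq_card (hsU x hxU).1, Fintype.card_fin]

theorem IsContactStructure.exists_sub_smul_mem (hH : IsContactStructure n H)
    {x : P} {e : TangentSpace 𝓘(ℝ, E) x} (he : e ∉ H x) (v : TangentSpace 𝓘(ℝ, E) x) :
    ∃ c : ℝ, v - c • e ∈ H x := by
  have : FiniteDimensional ℝ (TangentSpace 𝓘(ℝ, E) x) := inferInstanceAs (FiniteDimensional ℝ E)
  exact exists_sub_smul_mem_of_finrank hH.dim (hH.distribution.finrank_eq x) he v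

/-- The functional on `Q_x = T_xP / H_x` induced by a one-form which vanishes on `H`. -/
def quotientFunctional (hα : ∀ x, ∀ v ∈ H x, α x ![v] = 0) (x : P) :
    (TangentSpace 𝓘(ℝ, E) x ⧸ H x) →ₗ[ℝ] ℝ :=
  (H x).liftQ (α x).toFunctional fun v hv => hα x v hv

omit [FiniteDimensional ℝ E] [IsManifold 𝓘(ℝ, E) ∞ P] in
theorem quotientFunctional_mk (hα : ∀ x, ∀ v ∈ H x, α x ![v] = 0) {x : P}
    (v : TangentSpace 𝓘(ℝ, E) x) :
    quotientFunctional hα x (Submodule.Quotient.mk v) = α x ![v] := rfl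

/-- The restriction of `dα` to `H` is minus the Levi bracket composed with `α`. -/
theorem FormField.d_apply_eq_leviBracket {k : ℕ} (hH : IsSmoothDistribution H k)
    (hs : α.IsSmoothOn univ) (hα : ∀ x, ∀ v ∈ H x, α x ![v] = 0) {x : P} (v w : H x) :
    α.d x ![(v : TangentSpace 𝓘(ℝ, E) x), w] = - quotientFunctional hα x (leviBracket H x v w) := by
  obtain ⟨e, he⟩ := exists_linear_extension hH x
  rw [leviBracket_isInducedByLieBracket hH x _ _ (he v).1 (he w).1 v w (he v).2 (he w).2,
    quotientFunctional_mk]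
  obtain ⟨U, hU, hxU, h1, h2⟩ := (he v).1
  obtain ⟨V, hV, hxV, h3, h4⟩ := (he w).1
  rw [← FormField.d_apply_eq_neg_mlieBracket hs ((hU.inter hV).mem_nhds ⟨hxU, hxV⟩)
    (ContMDiffOn.mono h1 inter_subset_left) (ContMDiffOn.mono h3 inter_subset_right)
    (fun y hy => hα y _ (h2 y hy.1)) (fun y hy => hα y _ (h4 y hy.2)), (he v).2, (he w).2]

/-- On `H`, `dα` is `-α ∘ L`, and `α` is injective modulo `H`; a vector in the radical of `dα` on
`H` therefore lies in the radical of the Levi bracket. -/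
theorem IsContactStructure.isContactForm (hH : IsContactStructure n H) (hs : α.IsSmoothOn univ)
    (hα : ∀ x v, α x ![v] = 0 ↔ v ∈ H x) : IsContactForm H α where
  smooth := hs
  ker := hα
  nondegenerate := by
    intro x v hv h
    have hα' : ∀ x, ∀ v ∈ H x, α x ![v] = 0 := fun x v => (hα x v).2
    have h1 : (⟨v, hv⟩ : H x) = 0 := by
      refine (hH.nondegenerate x).1 _ fun w => ?_
      have h2 := FormField.d_apply_eq_leviBracket hH.distribution hs hα' ⟨v, hv⟩ w
      rw [h w w.2, zero_eq_neg] at h2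
      obtain ⟨m, hm⟩ := Submodule.Quotient.mk_surjective _ (leviBracket H x ⟨v, hv⟩ w)
      rw [← hm, quotientFunctional_mk, hα] at h2
      rw [← hm]
      exact (Submodule.Quotient.mk_eq_zero _).2 h2
    exact congrArg Subtype.val h1

/-- The tangent space splits as `H ⊕ ℝ ξ`, which prescribes `α` at each point. Smoothness and the
contact condition then follow from the frame criterion and `IsContactStructure.isContactForm`. -/
theorem IsContactStructure.existsUnique_contactForm (hH : IsContactStructure n H)
    (hξ : IsTransversalInfinitesimalAutomorphism H ξ) :
    ∃! α : FormField E P 1, IsContactForm H α ∧ ∀ x, α x ![ξ x] = 1 := by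
  have h1 : ∀ x, ∃ f : E →ₗ[ℝ] ℝ, f (ξ x) = 1 ∧ ∀ v, f v = 0 ↔ v ∈ H x := fun x =>
    exists_dual_ker_eq_of_finrank (V := E) hH.dim (hH.distribution.finrank_eq x) (hξ.transversal x)
  choose f hf1 hf2 using h1
  let α : FormField E P 1 := fun x => ContinuousAlternatingMap.ofSubsingleton ℝ E ℝ 0
    (LinearMap.toContinuousLinearMap (f x))
  have hα1 : ∀ x v, α x ![v] = f x v := fun x v => rfl
  have hker : ∀ x v, α x ![v] = 0 ↔ v ∈ H x := fun x v => hf2 x v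
  have hαξ : ∀ x, α x ![ξ x] = 1 := hf1
  refine ⟨α, ⟨hH.isContactForm (FormField.isSmoothOn_of_frame hH.dim hH.distribution hξ.smooth
    (fun x v => (hker x v).2) hαξ) hker, hαξ⟩, ?_⟩
  rintro α' ⟨h1, h2⟩
  funext x
  ext v
  have hv : v = ![v 0] := by funext i; fin_cases i; rfl
  rw [hv]
  obtain ⟨c, hc⟩ := hH.exists_sub_smul_mem (hξ.transversal x) (v 0)
  have h3 := (h1.ker x _).2 hc
  have h4 := (hker x _).2 hc
  rw [← ContinuousAlternatingMap.toFunctional_apply, map_sub, map_smul,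
    ContinuousAlternatingMap.toFunctional_apply, ContinuousAlternatingMap.toFunctional_apply] at h3 h4
  rw [h2, sub_eq_zero] at h3
  rw [hαξ, sub_eq_zero] at h4
  exact h3.trans h4.symm

/-- The contraction of `dα` with the infinitesimal automorphism vanishes. -/
theorem IsContactForm.d_apply_eq_zero (hα : IsContactForm H α) (hH : IsContactStructure n H)
    (hξ : IsTransversalInfinitesimalAutomorphism H ξ) (hαξ : ∀ x, α x ![ξ x] = 1) (x : P)
    (w : TangentSpace 𝓘(ℝ, E) x) : α.d x ![ξ x, w] = 0 := by
  -- The flow argument treats the component of `w` in `H`; the component along `ξ` contributes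
  -- nothing because `dα` is alternating.
  obtain ⟨c, hc⟩ := hH.exists_sub_smul_mem (hξ.transversal x) w
  obtain ⟨ε, U, φ, hx, hfl, hφ⟩ := hξ.flow_preserves x
  have h1 := FormField.d_apply_of_flow hH.distribution hα.smooth (fun x v => (hα.ker x v).2) hαξ
    hfl hφ hx hc
  rw [← ContinuousAlternatingMap.toBilin_apply, map_sub, map_smul,
    ContinuousAlternatingMap.toBilin_apply, ContinuousAlternatingMap.toBilin_apply,
    ContinuousAlternatingMap.apply_self, smul_zero, sub_zero] at h1
  exact h1

end Contact_Forms

/-! ### Local form of submersions and constancy along fibres -/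

section Submersions

variable {E : Type*} [NormedAddCommGroup E] [NormedSpace ℝ E]
  {P : Type*} [TopologicalSpace P] [ChartedSpace E P] [IsManifold 𝓘(ℝ, E) ∞ P]
  {F : Type*} [NormedAddCommGroup F] [NormedSpace ℝ F]
  {M : Type*} [TopologicalSpace M] [ChartedSpace F M]
  {q : P → M}

omit [IsManifold 𝓘(ℝ, E) ∞ P] in
/-- A submersion is, in suitable charts, a linear projection, which has sections through every
point. -/
theorem Manifold.IsSubmersion.exists_charts (hq : IsSubmersion 𝓘(ℝ, E) 𝓘(ℝ, F) ∞ q) (x : P) :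
    ∃ (c : OpenPartialHomeomorph P E) (d : OpenPartialHomeomorph M F) (p : E →L[ℝ] F) (S : F → E),
      c ∈ IsManifold.maximalAtlas 𝓘(ℝ, E) ∞ P ∧ d ∈ IsManifold.maximalAtlas 𝓘(ℝ, F) ∞ M ∧
      x ∈ c.source ∧ q x ∈ d.source ∧
      (∀ u ∈ c.target, p u ∈ d.target ∧ q (c.symm u) = d.symm (p u)) ∧
      ContDiff ℝ ∞ S ∧ (∀ w, p (S w) = w) ∧ S (d (q x)) = c x := by
  obtain ⟨K, _, _, hK⟩ := hq
  have h := hK x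
  have hw : ∀ u ∈ h.domChart.target, h.codChart (q (h.domChart.symm u)) = (h.equiv u).1 := by
    intro u hu
    have := h.writtenInCharts (show u ∈ (h.domChart.extend 𝓘(ℝ, E)).target by simpa [mfld_simps] using hu)
    simpa [mfld_simps] using this
  have hs : ∀ u ∈ h.domChart.target, q (h.domChart.symm u) ∈ h.codChart.source := fun u hu =>
    h.source_subset_preimage_source (h.domChart.map_target hu)
  -- The section freezes the kernel coordinate at its value at `x`, so that it passes through `c x`.
  refine ⟨h.domChart, h.codChart, (ContinuousLinearMap.fst ℝ F K).comp (h.equiv : E →L[ℝ] F × K),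
    fun w => h.equiv.symm (w, (h.equiv (h.domChart x)).2), h.domChart_mem_maximalAtlas,
    h.codChart_mem_maximalAtlas, h.mem_domChart_source, h.mem_codChart_source, ?_, ?_, ?_, ?_⟩
  · intro u hu
    have h1 : h.codChart (q (h.domChart.symm u)) = ((ContinuousLinearMap.fst ℝ F K).comp
      (h.equiv : E →L[ℝ] F × K)) u := hw u hu
    rw [← h1]
    exact ⟨h.codChart.map_source (hs u hu), (h.codChart.left_inv (hs u hu)).symm⟩
  · exact h.equiv.symm.contDiff.comp (contDiff_id.prodMk contDiff_const)
  · intro w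
    simp
  · have h1 := hw _ (h.domChart.map_source h.mem_domChart_source)
    rw [h.domChart.left_inv h.mem_domChart_source] at h1
    rw [h1]
    simp

omit [IsManifold 𝓘(ℝ, E) ∞ P] in
/-- A submersion has a smooth local section through every point, here expressed in the chart at
the image point. -/
theorem Manifold.IsSubmersion.exists_section (hq : IsSubmersion 𝓘(ℝ, E) 𝓘(ℝ, F) ∞ q) (x : P) :
    ∃ σ : F → P, ContMDiffAt 𝓘(ℝ, F) 𝓘(ℝ, E) ∞ σ (extChartAt 𝓘(ℝ, F) (q x) (q x)) ∧
      q ∘ σ =ᶠ[𝓝 (extChartAt 𝓘(ℝ, F) (q x) (q x))] (extChartAt 𝓘(ℝ, F) (q x)).symm := by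
  obtain ⟨c, d, p, S, hc, hd, hx, hqx, hcd, hS, hpS, hSx⟩ := hq.exists_charts x
  let b : F := extChartAt 𝓘(ℝ, F) (q x) (q x)
  have hb : (extChartAt 𝓘(ℝ, F) (q x)).symm b = q x := extChartAt_to_inv (q x)
  have h1 : ContMDiffAt 𝓘(ℝ, F) 𝓘(ℝ, E) ∞
      (fun w => S (d ((extChartAt 𝓘(ℝ, F) (q x)).symm w))) b := by
    have h2 : ContMDiffAt 𝓘(ℝ, F) 𝓘(ℝ, F) ∞ d ((extChartAt 𝓘(ℝ, F) (q x)).symm b) := by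
      rw [hb]; exact contMDiffAt_of_mem_maximalAtlas hd hqx
    exact hS.contMDiff.contMDiffAt.comp b (h2.comp b (contMDiffAt_extChartAt_symm_self (q x)))
  have h3 : S (d ((extChartAt 𝓘(ℝ, F) (q x)).symm b)) = c x := by rw [hb, hSx]
  refine ⟨fun w => c.symm (S (d ((extChartAt 𝓘(ℝ, F) (q x)).symm w))), ?_, ?_⟩
  · have h4 : ContMDiffAt 𝓘(ℝ, E) 𝓘(ℝ, E) ∞ c.symm
        (S (d ((extChartAt 𝓘(ℝ, F) (q x)).symm b))) := by
      rw [h3]; exact contMDiffAt_symm_of_mem_maximalAtlas hc (c.map_source hx)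
    exact h4.comp b h1
  · have h5 : ∀ᶠ w in 𝓝 b, S (d ((extChartAt 𝓘(ℝ, F) (q x)).symm w)) ∈ c.target := by
      refine h1.continuousAt ?_
      rw [h3]
      exact c.open_target.mem_nhds (c.map_source hx)
    filter_upwards [h5, eventually_extChartAt_symm (E := F) (d.open_source.mem_nhds hqx)]
      with w hw1 hw2
    have h6 := (hcd _ hw1).2
    rw [hpS, d.left_inv hw2.2] at h6
    exact h6

theorem extDeriv_two_form_apply {G : Type*} [NormedAddCommGroup G] [NormedSpace ℝ G]
    {β : G → G [⋀^Fin 2]→L[ℝ] ℝ} {p : G} (hβ : DifferentiableAt ℝ β p) (u v w : G) :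
    extDeriv β p ![u, v, w] = fderiv ℝ (fun y => β y ![v, w]) p u
      - fderiv ℝ (fun y => β y ![u, w]) p v + fderiv ℝ (fun y => β y ![u, v]) p w := by
  rw [extDeriv_apply hβ, Fin.sum_univ_three]
  have h0 : Fin.removeNth 0 ![u, v, w] = ![v, w] := by funext i; fin_cases i <;> rfl
  have h1 : Fin.removeNth 1 ![u, v, w] = ![u, w] := by funext i; fin_cases i <;> rfl
  have h2 : Fin.removeNth 2 ![u, v, w] = ![u, v] := by funext i; fin_cases i <;> rfl
  rw [h0, h1, h2]
  simp [sub_eq_add_neg]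

/-- A closed two-form whose contraction with `k` vanishes does not change in the direction `k`. -/
theorem apply_add_eq_of_extDeriv_eq_zero {G : Type*} [NormedAddCommGroup G] [NormedSpace ℝ G]
    {β : G → G [⋀^Fin 2]→L[ℝ] ℝ} {a k : G} {r : ℝ}
    (hβ : ∀ y ∈ Metric.ball a r, DifferentiableAt ℝ β y)
    (hd : ∀ y ∈ Metric.ball a r, extDeriv β y = 0)
    (hk : ∀ y ∈ Metric.ball a r, ∀ w, β y ![k, w] = 0) (ha : a + k ∈ Metric.ball a r) :
    β (a + k) = β a := by
  have hr : ∀ t ∈ Icc (0 : ℝ) 1, a + t • k ∈ Metric.ball a r := by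
    intro t ht
    rw [mem_ball_iff_norm, add_sub_cancel_left] at ha ⊢
    rw [norm_smul, Real.norm_of_nonneg ht.1]
    exact (mul_le_of_le_one_left (norm_nonneg k) ht.2).trans_lt ha
  have hconst : ∀ y ∈ Metric.ball a r, ∀ w, ∀ e, fderiv ℝ (fun y => β y ![k, w]) y e = 0 := by
    intro y hy w e
    have : (fun y => β y ![k, w]) =ᶠ[𝓝 y] fun _ => 0 := by
      filter_upwards [Metric.isOpen_ball.mem_nhds hy] with z hz
      exact hk z hz w
    rw [this.fderiv_eq]
    simp
  ext v
  have hv : v = ![v 0, v 1] := by funext i; fin_cases i <;> rfl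
  have hder : ∀ t ∈ Icc (0 : ℝ) 1, HasDerivAt (fun t : ℝ => β (a + t • k) v) 0 t := by
    intro t ht
    -- Closedness reads `∂_k β(v, w) = ∂_v β(k, w) - ∂_w β(k, v)`, and the right side vanishes
    -- because `β(k, ·)` is zero on the whole ball.
    have h1 := extDeriv_two_form_apply (hβ _ (hr t ht)) k (v 0) (v 1)
    rw [hd _ (hr t ht), hconst _ (hr t ht), hconst _ (hr t ht), ← hv, sub_zero, add_zero] at h1
    have h2 := ((hβ _ (hr t ht)).alternating_apply v).hasFDerivAt
    have h3 : HasDerivAt (fun t : ℝ => a + t • k) k t := by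
      simpa using ((hasDerivAt_id t).smul_const k).const_add a
    have h4 := h2.comp_hasDerivAt t h3
    rwa [← h1] at h4
  have := constant_of_has_deriv_right_zero
    (fun t ht => (hder t ht).continuousAt.continuousWithinAt)
    (fun t ht => (hder t (Ico_subset_Icc_self ht)).hasDerivWithinAt) 1 (by simp)
  simpa using this

variable [FiniteDimensional ℝ E]

/-- The forms on the base which correspond to a closed two-form with vanishing contraction with
the vertical vectors are locally constant along the fibres of a submersion. -/
theorem eventually_eq_of_closed_basic (hq : IsSubmersion 𝓘(ℝ, E) 𝓘(ℝ, F) ∞ q)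
    (hsurj : ∀ x, Function.Surjective (mfderiv 𝓘(ℝ, E) 𝓘(ℝ, F) q x))
    {β : FormField E P 2} (hβ : β.IsSmoothOn univ) (hd : β.d = 0)
    (hk : ∀ x (v w : TangentSpace 𝓘(ℝ, E) x), mfderiv 𝓘(ℝ, E) 𝓘(ℝ, F) q x v = 0 →
      β x ![v, w] = 0)
    {Ω : P → F [⋀^Fin 2]→L[ℝ] ℝ}
    (hΩ : ∀ x (v w : E), Ω x ![mfderiv 𝓘(ℝ, E) 𝓘(ℝ, F) q x v, mfderiv 𝓘(ℝ, E) 𝓘(ℝ, F) q x w]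
      = β x ![v, w]) (x : P) :
    ∀ᶠ y in 𝓝 x, q y = q x → Ω y = Ω x := by
  obtain ⟨c, d, p, S, hc, hd', hx, hqx, hcd, -⟩ := hq.exists_charts x
  have hg : ∀ u ∈ c.target, ContMDiffAt 𝓘(ℝ, E) 𝓘(ℝ, E) ∞ c.symm u := fun u hu =>
    contMDiffAt_symm_of_mem_maximalAtlas hc hu
  have hqg : ∀ u ∈ c.target, ∀ v : E, (mfderiv 𝓘(ℝ, E) 𝓘(ℝ, F) q (c.symm u)
      (mfderiv 𝓘(ℝ, E) 𝓘(ℝ, E) c.symm u v) : F)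
        = mfderiv 𝓘(ℝ, F) 𝓘(ℝ, F) d.symm (p u) (p v) := by
    intro u hu v
    have h1 : q ∘ c.symm =ᶠ[𝓝 u] d.symm ∘ p := by
      filter_upwards [c.open_target.mem_nhds hu] with z hz
      exact (hcd z hz).2
    have h2 : (mfderiv 𝓘(ℝ, E) 𝓘(ℝ, F) (q ∘ c.symm) u : E →L[ℝ] F)
      = mfderiv 𝓘(ℝ, E) 𝓘(ℝ, F) (d.symm ∘ p) u := h1.mfderiv_eq
    have h3 := mfderiv_comp_fderiv_apply (f := p) (y := u) (g := d.symm)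
      ((contMDiffAt_symm_of_mem_maximalAtlas hd' (hcd u hu).1).mdifferentiableAt (by simp))
      p.differentiableAt v
    rw [p.fderiv] at h3
    refine Eq.trans ?_ h3
    rw [mfderiv_comp u (hq.contMDiff.contMDiffAt.mdifferentiableAt (by simp))
      ((hg u hu).mdifferentiableAt (by simp))] at h2
    exact congrArg (fun A : E →L[ℝ] F => A v) h2
  have hgsurj : ∀ u ∈ c.target, Function.Surjective
      (mfderiv 𝓘(ℝ, E) 𝓘(ℝ, E) c.symm u : E →L[ℝ] E) := by
    intro u hu
    let A : E →L[ℝ] E := mfderiv 𝓘(ℝ, E) 𝓘(ℝ, E) c.symm u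
    refine (LinearMap.injective_iff_surjective (f := A.toLinearMap)).1 ?_
    have h1 : c ∘ c.symm =ᶠ[𝓝 u] id := by
      filter_upwards [c.open_target.mem_nhds hu] with z hz
      exact c.right_inv hz
    have h2 : (mfderiv 𝓘(ℝ, E) 𝓘(ℝ, E) (c ∘ c.symm) u : E →L[ℝ] E)
      = mfderiv 𝓘(ℝ, E) 𝓘(ℝ, E) id u := h1.mfderiv_eq
    rw [mfderiv_comp u ((contMDiffAt_of_mem_maximalAtlas hc
      (c.map_target hu)).mdifferentiableAt (by simp)) ((hg u hu).mdifferentiableAt (by simp)),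
      mfderiv_id] at h2
    intro v w hvw
    have h3 : ∀ v, mfderiv 𝓘(ℝ, E) 𝓘(ℝ, E) c (c.symm u)
        (mfderiv 𝓘(ℝ, E) 𝓘(ℝ, E) c.symm u v) = v := fun v =>
      congrArg (fun A : E →L[ℝ] E => A v) h2
    exact (h3 v).symm.trans ((congrArg (mfderiv 𝓘(ℝ, E) 𝓘(ℝ, E) c (c.symm u)) hvw).trans (h3 w))
  have hsm : ∀ u ∈ c.target, β.SmoothAt (c.symm u) := fun u _ => hβ _ (mem_univ _)
  obtain ⟨r, hr, hball⟩ := Metric.isOpen_iff.1 c.open_target (c x) (c.map_source hx)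
  have hnear : ∀ᶠ y in 𝓝 x, y ∈ c.source ∧ c y ∈ Metric.ball (c x) r :=
    Filter.Eventually.and (c.open_source.mem_nhds hx) ((c.continuousAt hx).eventually (Metric.ball_mem_nhds _ hr))
  filter_upwards [hnear] with y ⟨hy, hyr⟩ hqy
  -- In these charts `q` is the linear map `p`, so points of one fibre differ by a vector of `ker
  -- p`, which is vertical at every point of the chart.
  have hp : p (c y) = p (c x) := by
    have h1 := hcd _ (c.map_source hy)
    have h2 := hcd _ (c.map_source hx)
    rw [c.left_inv hy] at h1
    rw [c.left_inv hx] at h2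
    exact d.symm.injOn h1.1 h2.1 (by rw [← h1.2, ← h2.2, hqy])
  have hβeq : β.along c.symm (c y) = β.along c.symm (c x) := by
    have := apply_add_eq_of_extDeriv_eq_zero (β := β.along c.symm) (a := c x) (k := c y - c x)
      (r := r) (fun u hu => ((hsm u (hball hu)).along (hg u (hball hu))).differentiableAt (by simp))
      (fun u hu => by
        rw [(hsm u (hball hu)).extDeriv_along (hg u (hball hu)), hd]
        ext v; rfl)
      (fun u hu w => by
        rw [FormField.along_apply]
        refine Eq.trans (congrArg _ (funext fun i => ?_)) (hk (c.symm u)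
          (mfderiv 𝓘(ℝ, E) 𝓘(ℝ, E) c.symm u (c y - c x))
          (mfderiv 𝓘(ℝ, E) 𝓘(ℝ, E) c.symm u w) ?_)
        · fin_cases i <;> rfl
        · refine (hqg u (hball hu) _).trans ?_
          rw [map_sub, hp, sub_self]
          exact map_zero _)
      (by rwa [add_sub_cancel])
    rwa [add_sub_cancel] at this
  -- Here `β` is the pullback of `Ω` by the derivative of `d.symm ∘ p`. At `c x` and `c y` both `β`
  -- and this derivative agree, and the derivative is onto, so the two values of `Ω` coincide.
  have hΩ' : ∀ u ∈ c.target, ∀ v w : E, Ω (c.symm u)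
      ![mfderiv 𝓘(ℝ, F) 𝓘(ℝ, F) d.symm (p u) (p v), mfderiv 𝓘(ℝ, F) 𝓘(ℝ, F) d.symm (p u) (p w)]
        = β.along c.symm u ![v, w] := by
    intro u hu v w
    rw [← hqg u hu v, ← hqg u hu w]
    refine (hΩ _ _ _).trans (congrArg _ (funext fun i => ?_))
    fin_cases i <;> rfl
  have hsurj' : ∀ v : F, ∃ v' : E, mfderiv 𝓘(ℝ, F) 𝓘(ℝ, F) d.symm (p (c x)) (p v') = v := by
    intro v
    obtain ⟨v₁, hv₁⟩ := hsurj (c.symm (c x)) v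
    obtain ⟨v₂, hv₂⟩ := hgsurj (c x) (c.map_source hx) v₁
    refine ⟨v₂, ?_⟩
    rw [← hqg (c x) (c.map_source hx) v₂, ← hv₁]
    exact congrArg _ hv₂
  ext v
  obtain ⟨v₀, hv₀⟩ := hsurj' (v 0)
  obtain ⟨v₁, hv₁⟩ := hsurj' (v 1)
  have e1 := hΩ' (c y) (c.map_source hy) v₀ v₁
  have e2 := hΩ' (c x) (c.map_source hx) v₀ v₁
  have hv : v = ![v 0, v 1] := by funext i; fin_cases i <;> rfl
  rw [c.left_inv hy, hp, hβeq, ← e2, c.left_inv hx, hv₀, hv₁, ← hv] at e1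
  exact e1

end Submersions

/-! ### Recovering a form on the base from its pullback -/

section Descent

variable {E : Type*} [NormedAddCommGroup E] [NormedSpace ℝ E]
  {P : Type*} [TopologicalSpace P] [ChartedSpace E P] [IsManifold 𝓘(ℝ, E) ∞ P]
  {F : Type*} [NormedAddCommGroup F] [NormedSpace ℝ F]
  {M : Type*} [TopologicalSpace M] [ChartedSpace F M]
  {q : P → M} {k : ℕ}

omit [IsManifold 𝓘(ℝ, E) ∞ P] in
theorem FormField.along_comp_eq_pullback_along {G : Type*} [NormedAddCommGroup G]
    [NormedSpace ℝ G] (τ : FormField F M k) {σ : G → P} {w : G}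
    (hq : MDifferentiableAt 𝓘(ℝ, E) 𝓘(ℝ, F) q (σ w))
    (hσ : MDifferentiableAt 𝓘(ℝ, G) 𝓘(ℝ, E) σ w) :
    τ.along (q ∘ σ) w = (τ.pullback (E := E) q).along σ w := by
  ext v
  refine (τ.along_apply _ _ _).trans ?_
  rw [mfderiv_comp w hq hσ]
  rfl

/-- Near a point of the base, a form is computed from its pullback under a submersion. -/
theorem FormField.inChart_eventuallyEq_pullback_along (hq : IsSubmersion 𝓘(ℝ, E) 𝓘(ℝ, F) ∞ q)
    (τ : FormField F M k) {x : P} {σ : F → P}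
    (hσ : ContMDiffAt 𝓘(ℝ, F) 𝓘(ℝ, E) ∞ σ (extChartAt 𝓘(ℝ, F) (q x) (q x)))
    (hqσ : q ∘ σ =ᶠ[𝓝 (extChartAt 𝓘(ℝ, F) (q x) (q x))] (extChartAt 𝓘(ℝ, F) (q x)).symm) :
    τ.inChart (q x) =ᶠ[𝓝 (extChartAt 𝓘(ℝ, F) (q x) (q x))] (τ.pullback (E := E) q).along σ := by
  filter_upwards [eventually_eventually_nhds.2 hqσ, hσ.eventually_mdifferentiableAt] with w h1 h2
  rw [← τ.along_comp_eq_pullback_along (hq.contMDiff.contMDiffAt.mdifferentiableAt (by simp)) h2]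
  exact (τ.along_congr h1).symm

/-- With a local section `σ` of `q`, `τ = (q ∘ σ)^* τ = σ^*(q^* τ)` in the chart, and pullback along
a smooth map preserves smoothness. -/
theorem FormField.isSmoothOn_of_pullback (hq : IsSubmersion 𝓘(ℝ, E) 𝓘(ℝ, F) ∞ q)
    (hsurj : Function.Surjective q) {τ : FormField F M k}
    (h : (τ.pullback (E := E) q).IsSmoothOn univ) : τ.IsSmoothOn univ := by
  intro y _
  obtain ⟨x, rfl⟩ := hsurj y
  obtain ⟨σ, hσ, hqσ⟩ := hq.exists_section x
  refine ContDiffAt.congr_of_eventuallyEq ?_ (τ.inChart_eventuallyEq_pullback_along hq hσ hqσ)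
  exact FormField.SmoothAt.along (h _ (mem_univ _)) hσ

/-- The same identity `τ = σ^*(q^* τ)` is combined with naturality of `d`. -/
theorem FormField.d_eq_zero_of_pullback (hq : IsSubmersion 𝓘(ℝ, E) 𝓘(ℝ, F) ∞ q)
    (hsurj : Function.Surjective q) {τ : FormField F M k}
    (h : (τ.pullback (E := E) q).IsSmoothOn univ)
    (hd : (τ.pullback (E := E) q).d = 0) : τ.d = 0 := by
  funext y
  obtain ⟨x, rfl⟩ := hsurj y
  obtain ⟨σ, hσ, hqσ⟩ := hq.exists_section x
  have h1 := (τ.inChart_eventuallyEq_pullback_along hq hσ hqσ).extDeriv_eq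
  rw [FormField.SmoothAt.extDeriv_along (h _ (mem_univ _)) hσ, hd] at h1
  rw [FormField.d, h1]
  rfl

/-- A two-form descends along a surjective linear map if its contraction with the kernel
vanishes. -/
theorem exists_two_form_of_surjective [FiniteDimensional ℝ F] {D : E →L[ℝ] F}
    (hD : Function.Surjective D) {φ : E [⋀^Fin 2]→L[ℝ] ℝ}
    (hφ : ∀ v w, D v = 0 → φ ![v, w] = 0) :
    ∃ ψ : F [⋀^Fin 2]→L[ℝ] ℝ, ∀ v w, ψ ![D v, D w] = φ ![v, w] := by
  -- Any linear section `R` of `D` serves: `R (D v)` differs from `v` by an element of the kernel,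
  -- which `φ` does not see.
  obtain ⟨R, hR⟩ := (D : E →ₗ[ℝ] F).exists_rightInverse_of_surjective
    (LinearMap.range_eq_top.2 hD)
  have hR' : ∀ w, D (R w) = w := fun w => LinearMap.congr_fun hR w
  have h1 : ∀ v w, φ ![R (D v), w] = φ ![v, w] := by
    intro v w
    have := hφ (R (D v) - v) w (by rw [map_sub, hR', sub_self])
    rw [← φ.toBilin_apply, map_sub, LinearMap.sub_apply, sub_eq_zero] at this
    exact this
  refine ⟨φ.compContinuousLinearMap (LinearMap.toContinuousLinearMap R), fun v w => ?_⟩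
  have h2 : φ.compContinuousLinearMap (LinearMap.toContinuousLinearMap R) ![D v, D w]
      = φ ![R (D v), R (D w)] := by
    refine congrArg φ (funext fun i => ?_)
    fin_cases i <;> rfl
  rw [h2, h1, φ.apply_swap, h1, ← φ.apply_swap]

end Descent

/-! ### The quotient: isomorphism on `H`, descent of `dα`, Levi forms -/

section Quotient

variable {E : Type*} [NormedAddCommGroup E] [NormedSpace ℝ E] [FiniteDimensional ℝ E]
  {P : Type*} [TopologicalSpace P] [ChartedSpace E P] [IsManifold 𝓘(ℝ, E) ∞ P]
  {F : Type*} [NormedAddCommGroup F] [NormedSpace ℝ F] [FiniteDimensional ℝ F]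
  {M : Type*} [TopologicalSpace M] [ChartedSpace F M]
  {H : (x : P) → Submodule ℝ (TangentSpace 𝓘(ℝ, E) x)} {ξ : (x : P) → TangentSpace 𝓘(ℝ, E) x}
  {q : P → M} {n : ℕ}

omit [IsManifold 𝓘(ℝ, E) ∞ P] in
-- Rank-nullity: the kernel is a line, so the rank is `2n`, the dimension of the base.
theorem IsQuotientByField.mfderiv_surjective (hq : IsQuotientByField (F := F) n ξ q)
    (hE : Module.finrank ℝ E = 2 * n + 1) {x : P} (hξ : ξ x ≠ 0) :
    Function.Surjective (mfderiv 𝓘(ℝ, E) 𝓘(ℝ, F) q x) := by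
  let D : E →ₗ[ℝ] F := (mfderiv 𝓘(ℝ, E) 𝓘(ℝ, F) q x).toLinearMap
  let e : E := ξ x
  have h1 : D.ker = Submodule.span ℝ {e} := hq.ker x
  have h2 := D.finrank_range_add_finrank_ker
  have he : e ≠ 0 := hξ
  rw [h1, finrank_span_singleton he, hE] at h2
  have h3 : D.range = ⊤ := by
    refine Submodule.eq_top_of_finrank_eq ?_
    rw [hq.dim]
    omega
  exact LinearMap.range_eq_top.1 h3

omit [FiniteDimensional ℝ E] [IsManifold 𝓘(ℝ, E) ∞ P] [FiniteDimensional ℝ F] in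
theorem IsQuotientByField.mfderiv_eq_zero_iff (hq : IsQuotientByField (F := F) n ξ q) {x : P}
    {v : TangentSpace 𝓘(ℝ, E) x} :
    mfderiv 𝓘(ℝ, E) 𝓘(ℝ, F) q x v = 0 ↔ ∃ c : ℝ, c • ξ x = v := by
  rw [← Submodule.mem_span_singleton, ← hq.ker x, LinearMap.mem_ker]
  rfl

/-- The kernel of `Tq` is the line of `ξ`, a complement of `H`: it meets `H` only in zero, and
subtracting a multiple of `ξ` moves any preimage into `H`. -/
theorem IsQuotientByField.tangentRestrict_bijective (hq : IsQuotientByField (F := F) n ξ q)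
    (hH : IsContactStructure n H) (hξ : ∀ x, ξ x ∉ H x) (x : P) :
    Function.Bijective (tangentRestrict (F := F) H q x) := by
  constructor
  · rw [injective_iff_map_eq_zero]
    intro v hv
    obtain ⟨c, hc⟩ : ∃ c : ℝ, c • ξ x = (v : TangentSpace 𝓘(ℝ, E) x) :=
      hq.mfderiv_eq_zero_iff.1 hv
    have hc0 : c = 0 := by
      by_contra h
      refine hξ x ?_
      have := (H x).smul_mem c⁻¹ v.2
      rwa [← hc, smul_smul, inv_mul_cancel₀ h, one_smul] at this
    rw [hc0, zero_smul] at hc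
    exact Subtype.ext hc.symm
  · intro y
    have h0 : ξ x ≠ 0 := fun h => hξ x (h ▸ (H x).zero_mem)
    obtain ⟨v, hv⟩ := hq.mfderiv_surjective hH.dim h0 y
    obtain ⟨c, hc⟩ := hH.exists_sub_smul_mem (hξ x) v
    refine ⟨⟨_, hc⟩, ?_⟩
    change mfderiv 𝓘(ℝ, E) 𝓘(ℝ, F) q x (v - c • ξ x) = y
    rw [map_sub, hq.mfderiv_eq_zero_iff.2 ⟨c, rfl⟩, sub_zero, hv]

/-- A closed two-form whose contraction with the vertical vectors vanishes descends to the
quotient. -/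
theorem IsQuotientByField.exists_pullback_eq (hq : IsQuotientByField (F := F) n ξ q)
    (hE : Module.finrank ℝ E = 2 * n + 1) (hξ : ∀ x, ξ x ≠ 0) {β : FormField E P 2}
    (hβ : β.IsSmoothOn univ) (hd : β.d = 0) (hk : ∀ x w, β x ![ξ x, w] = 0) :
    ∃ τ : FormField F M 2, τ.IsSmoothOn univ ∧ τ.d = 0 ∧ τ.pullback q = β := by
  have hsurj : ∀ x, Function.Surjective (mfderiv 𝓘(ℝ, E) 𝓘(ℝ, F) q x) := fun x =>
    hq.mfderiv_surjective hE (hξ x)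
  have hk' : ∀ x (v w : TangentSpace 𝓘(ℝ, E) x), mfderiv 𝓘(ℝ, E) 𝓘(ℝ, F) q x v = 0 →
      β x ![v, w] = 0 := by
    intro x v w hv
    obtain ⟨c, rfl⟩ := hq.mfderiv_eq_zero_iff.1 hv
    rw [← ContinuousAlternatingMap.toBilin_apply, map_smul, LinearMap.smul_apply,
      ContinuousAlternatingMap.toBilin_apply, hk, smul_zero]
  have hex : ∀ x, ∃ ψ : F [⋀^Fin 2]→L[ℝ] ℝ, ∀ v w : E,
      ψ ![mfderiv 𝓘(ℝ, E) 𝓘(ℝ, F) q x v, mfderiv 𝓘(ℝ, E) 𝓘(ℝ, F) q x w] = β x ![v, w] := fun x =>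
    exists_two_form_of_surjective (E := E) (F := F) (hsurj x) (hk' x)
  choose Ω hΩ using hex
  -- Equality of the values of `Ω` is an equivalence relation that holds locally on a fibre;
  -- connectedness makes it hold globally, so the choice of preimage in `τ` is immaterial.
  have hconst : ∀ x y, q x = q y → Ω x = Ω y := by
    intro x y hxy
    refine (hq.connected (q y)).isPreconnected.induction₂ (fun x y => Ω y = Ω x) ?_ ?_ ?_
      (x := y) (y := x) rfl hxy
    · intro z hz
      filter_upwards [nhdsWithin_le_nhds (eventually_eq_of_closed_basic hq.submersion hsurj hβ hd
        hk' hΩ z), self_mem_nhdsWithin] with w hw hw'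
      exact hw (Eq.trans hw' (Eq.symm hz))
    · exact fun a b c _ _ _ h1 h2 => h2.trans h1
    · exact fun a b _ _ h => h.symm
  let τ : FormField F M 2 := fun y => Ω (Function.surjInv hq.surjective y)
  have hτ : τ.pullback q = β := by
    funext x
    ext v
    have hv : v = ![v 0, v 1] := by funext i; fin_cases i <;> rfl
    have h1 : Ω (Function.surjInv hq.surjective (q x)) = Ω x :=
      hconst _ _ (Function.surjInv_eq hq.surjective (q x))
    have h2 := hΩ x (v 0) (v 1)
    rw [← h1] at h2
    rw [hv]
    refine Eq.trans (congrArg (Ω (Function.surjInv hq.surjective (q x))) (funext fun i => ?_)) h2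
    fin_cases i <;> rfl
  refine ⟨τ, FormField.isSmoothOn_of_pullback hq.submersion hq.surjective (E := E) ?_,
    FormField.d_eq_zero_of_pullback hq.submersion hq.surjective (E := E) ?_ ?_, hτ⟩ <;>
  rwa [hτ]

omit [IsManifold 𝓘(ℝ, E) ∞ P] [FiniteDimensional ℝ E] [FiniteDimensional ℝ F] in
-- Every point of the base and every tangent vector there has a preimage. This yields uniqueness of
-- `ω`.
theorem FormField.pullback_injective {k : ℕ} (hq : Function.Surjective q)
    (hsurj : ∀ x, Function.Surjective (mfderiv 𝓘(ℝ, E) 𝓘(ℝ, F) q x)) :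
    Function.Injective (FormField.pullback q : FormField F M k → FormField E P k) := by
  intro τ τ' h
  funext y
  obtain ⟨x, rfl⟩ := hq y
  ext v
  choose R hR using hsurj x
  have h1 := congrArg (fun φ : TangentSpace 𝓘(ℝ, E) x [⋀^Fin k]→L[ℝ] ℝ => φ fun i => R (v i))
    (congrFun h x)
  have h2 : ∀ ρ : FormField F M k, (ρ.pullback q : FormField E P k) x (fun i => R (v i))
      = ρ (q x) v := fun ρ => congrArg (ρ (q x)) (funext fun i => hR (v i))
  exact (h2 τ).symm.trans (h1.trans (h2 τ'))

variable {α : FormField E P 1} {τ : FormField F M 2}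

omit [IsManifold 𝓘(ℝ, E) ∞ P] [FiniteDimensional ℝ E] [FiniteDimensional ℝ F] in
theorem FormField.apply_tangentRestrict {β : FormField E P 2} (hτ : τ.pullback q = β) {x : P}
    (v w : H x) : τ (q x) ![tangentRestrict (F := F) H q x v, tangentRestrict (F := F) H q x w]
      = β x ![(v : TangentSpace 𝓘(ℝ, E) x), w] := by
  rw [← hτ]
  refine congrArg (τ (q x)) (funext fun i => ?_)
  fin_cases i <;> rfl

omit [IsManifold 𝓘(ℝ, E) ∞ P] [FiniteDimensional ℝ E] [FiniteDimensional ℝ F] in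
-- The isomorphism `H_x → T_{q(x)}M` identifies `τ` with the restriction of `dα` to `H`.
theorem IsContactForm.nondegenerate_of_pullback (hα : IsContactForm H α)
    (hτ : τ.pullback q = α.d) {x : P}
    (hb : Function.Bijective (tangentRestrict (F := F) H q x)) :
    IsNondegenerateTwoForm (τ (q x)) := by
  intro v hv
  obtain ⟨v', rfl⟩ := hb.2 v
  have h1 := hα.nondegenerate x v' v'.2 fun w hw => by
    rw [← FormField.apply_tangentRestrict (H := H) hτ v' ⟨w, hw⟩]
    exact hv _
  rw [show v' = 0 from Subtype.ext h1, map_zero]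

omit [FiniteDimensional ℝ F] in
/-- The two-forms determined by the Levi bracket are the multiples of a form which pulls back to
the exterior derivative of the contact form. -/
theorem IsContactForm.leviForms_eq_span (hα : IsContactForm H α) (hH : IsContactStructure n H)
    (hξ : ∀ x, ξ x ∉ H x) (hαξ : ∀ x, α x ![ξ x] = 1) (hτ : τ.pullback q = α.d) {x : P}
    (hb : Function.Bijective (tangentRestrict (F := F) H q x)) :
    leviForms H q x = Submodule.span ℝ {τ (q x)} := by
  have hα' : ∀ x, ∀ v ∈ H x, α x ![v] = 0 := fun x v => (hα.ker x v).2
  have hlevi : ∀ v w : H x,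
      τ (q x) ![tangentRestrict (F := F) H q x v, tangentRestrict (F := F) H q x w]
        = - quotientFunctional hα' x (leviBracket H x v w) := fun v w => by
    rw [FormField.apply_tangentRestrict hτ,
      FormField.d_apply_eq_leviBracket hH.distribution hα.smooth hα']
  ext φ
  rw [Submodule.mem_span_singleton]
  constructor
  · rintro ⟨κ, hκ⟩
    -- The class of `ξ` spans `Q_x` and `α` takes the value one on it, so `κ` is `κ([ξ])` times the
    -- functional of `α`.
    have hκ' : ∀ m, κ m = quotientFunctional hα' x m * κ (Submodule.Quotient.mk (ξ x)) := by
      intro m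
      obtain ⟨v, rfl⟩ := Submodule.Quotient.mk_surjective _ m
      obtain ⟨c, hc⟩ := hH.exists_sub_smul_mem (hξ x) v
      have h1 : (Submodule.Quotient.mk v : TangentSpace 𝓘(ℝ, E) x ⧸ H x)
          = c • Submodule.Quotient.mk (ξ x) := by
        rw [← Submodule.Quotient.mk_smul]
        exact (Submodule.Quotient.eq _).2 hc
      rw [h1, map_smul, map_smul, quotientFunctional_mk, hαξ]
      simp
    -- The sign comes from `dα = -α ∘ L` on `H`.
    refine ⟨-κ (Submodule.Quotient.mk (ξ x)), ?_⟩
    ext u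
    obtain ⟨v, hv⟩ := hb.2 (u 0)
    obtain ⟨w, hw⟩ := hb.2 (u 1)
    have hu : u = ![tangentRestrict (F := F) H q x v, tangentRestrict (F := F) H q x w] := by
      funext i; fin_cases i
      · exact hv.symm
      · exact hw.symm
    rw [hu, hκ, hκ' (leviBracket H x v w), ContinuousAlternatingMap.smul_apply, hlevi, smul_eq_mul]
    ring
  · rintro ⟨c, rfl⟩
    refine ⟨-c • quotientFunctional hα' x, fun v w => ?_⟩
    rw [ContinuousAlternatingMap.smul_apply, hlevi]
    simp

end Quotient

/-! ### The proposition -/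

theorem proposition2p2
    {E : Type*} [NormedAddCommGroup E] [NormedSpace ℝ E] [FiniteDimensional ℝ E]
    {F : Type*} [NormedAddCommGroup F] [NormedSpace ℝ F] [FiniteDimensional ℝ F]
    {P : Type*} [TopologicalSpace P] [T2Space P] [ChartedSpace E P] [IsManifold 𝓘(ℝ, E) ∞ P]
    {M : Type*} [TopologicalSpace M] [T2Space M] [ChartedSpace F M] [IsManifold 𝓘(ℝ, F) ∞ M]
    (n : ℕ) (hn : 1 ≤ n)
    (H : (x : P) → Submodule ℝ (TangentSpace 𝓘(ℝ, E) x)) (hH : IsContactStructure n H)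
    (ξ : (x : P) → TangentSpace 𝓘(ℝ, E) x) (hξ : IsTransversalInfinitesimalAutomorphism H ξ)
    (q : P → M) (hq : IsQuotientByField (F := F) n ξ q) :
    (∀ x, Function.Bijective (tangentRestrict (F := F) H q x)) ∧
    ∃ ℓ : (y : M) → Submodule ℝ (TangentSpace 𝓘(ℝ, F) y [⋀^Fin 2]→L[ℝ] ℝ),
      (∀ x, ℓ (q x) = leviForms H q x) ∧
      IsLineSubbundle ℓ ∧
      (∀ y, ∀ φ ∈ ℓ y, φ ≠ 0 → IsNondegenerateTwoForm φ) ∧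
      (∃! α : FormField E P 1, IsContactForm H α ∧ ∀ x, α x ![ξ x] = 1) ∧
      (∀ α : FormField E P 1, (IsContactForm H α ∧ ∀ x, α x ![ξ x] = 1) →
        (∃! τ : FormField F M 2, IsSymplecticForm τ ∧ τ.pullback q = α.d) ∧
        (∀ τ : FormField F M 2, (IsSymplecticForm τ ∧ τ.pullback q = α.d) → ∀ y, τ y ∈ ℓ y)) ∧
      IsConformallySymplectic ℓ := by
  have hbij := hq.tangentRestrict_bijective hH hξ.transversal
  have hξ0 : ∀ x, ξ x ≠ 0 := fun x h => hξ.transversal x (h ▸ (H x).zero_mem)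
  have hsurj : ∀ x, Function.Surjective (mfderiv 𝓘(ℝ, E) 𝓘(ℝ, F) q x) := fun x =>
    hq.mfderiv_surjective hH.dim (hξ0 x)
  have hinj := FormField.pullback_injective (k := 2) hq.surjective hsurj
  have hαu := hH.existsUnique_contactForm hξ
  obtain ⟨α, ⟨hα, hαξ⟩, huniq⟩ := id hαu
  obtain ⟨Ω, hωs, hωd, hωq⟩ := hq.exists_pullback_eq hH.dim hξ0 hα.smooth.d hα.smooth.d_d
    (fun x w => hα.d_apply_eq_zero hH hξ hαξ x w)
  have hnd : ∀ y, IsNondegenerateTwoForm (Ω y) := by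
    intro y
    obtain ⟨x, rfl⟩ := hq.surjective y
    exact hα.nondegenerate_of_pullback hωq (hbij x)
  -- Positive dimension is needed here: on a zero space the zero form is non-degenerate.
  have hω0 : ∀ y, Ω y ≠ 0 := by
    intro y h0
    have : Nontrivial F := Module.nontrivial_of_finrank_pos (R := ℝ) (by rw [hq.dim]; omega)
    obtain ⟨v, hv⟩ := exists_ne (0 : F)
    exact hv (hnd y v fun w => by rw [h0]; rfl)
  have hline : IsLineSubbundle fun y => Submodule.span ℝ {Ω y} := fun y =>
    ⟨univ, isOpen_univ, mem_univ y, Ω, hωs, fun z _ => ⟨hω0 z, rfl⟩⟩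
  have hspan : ∀ y, ∀ φ ∈ Submodule.span ℝ {Ω y}, φ ≠ 0 → IsNondegenerateTwoForm φ := by
    intro y φ hφ hφ0 v hv
    obtain ⟨c, rfl⟩ := Submodule.mem_span_singleton.1 hφ
    have hc : c ≠ 0 := fun h => hφ0 (by rw [h, zero_smul])
    refine hnd y v fun w => ?_
    have := hv w
    rw [ContinuousAlternatingMap.smul_apply, smul_eq_mul] at this
    exact (mul_eq_zero.1 this).resolve_left hc
  -- The global form `Ω` trivializes `ℓ`, so `univ` serves as the neighbourhood in every local
  -- condition.
  refine ⟨hbij, fun y => Submodule.span ℝ {Ω y}, fun x =>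
    (hα.leviForms_eq_span hH hξ.transversal hαξ hωq (hbij x)).symm, hline, hspan, hαu, ?_,
    hline, hspan, fun y => ⟨univ, isOpen_univ, mem_univ y, Ω, hωs, fun z _ =>
      ⟨Submodule.mem_span_singleton_self _, hω0 z, congrFun hωd z⟩⟩⟩
  intro α' hα'
  obtain rfl := huniq α' hα'
  refine ⟨⟨Ω, ⟨⟨hωs, hωd, hnd⟩, hωq⟩, fun τ hτ => hinj (hτ.2.trans hωq.symm)⟩, fun τ hτ y => ?_⟩
  rw [hinj (hτ.2.trans hωq.symm)]
  exact Submodule.mem_span_singleton_self _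

end
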